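/- Let $d\ge 1$ and let $\Omega\subset\mathbb R^d$ be a domain (a non-empty connected open set) of finite Lebesgue measure. Let $H^2_0(\Omega)$ be the closure of $C_c^\infty(\Omega)$ in the real Sobolev space $H^2(\Omega)$. Call $\sigma\in\mathbb R$ a buckling eigenvalue of $\Omega$ if there is $v\in H^2_0(\Omega)$, $v\ne 0$, such that $$\int_\Omega \Delta v\,\Delta w\,dx=\sigma\int_\Omega\nabla v\cdot\nabla w\,dx\qquad\text{for all } w\in H^2_0(\Omega).$$ Then the buckling eigenvalues have finite multiplicity and, repeated according to multiplicity, form a sequence $0<\sigma_1\le\sigma_2\le\cdots$ tending to $+\infty$. Moreover, for every real-valued $\phi\in H^2_0(\Omega)\cap L^\infty(\Omega)$ and every $z>0$, $$\|\phi\|_\infty^2\sum_{j}(z-\sigma_j)_+\sigma_j\ \ge\ \frac{2d\,B_d\,\|\phi\|_2^2}{(d+2)(d+4)}(2\pi)^{-d}z^{2+\frac d2}-B_d(2\pi)^{-d}\|\nabla\phi\|_2^2\,z^{1+\frac d2}-B_d(2\pi)^{-d}\|\Delta\phi\|_2^2\,z^{\frac d2},$$ where $a_+=\max(a,0)$, the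 sum (over $j\ge1$) has only finitely many non-zero terms, $\|\cdot\|_2$ and $\|\cdot\|_\infty$ are the norms on $\Omega$, and $B_d$ is the Lebesgue measure of the unit ball of $\mathbb R^d$. -/

import Mathlib

open MeasureTheory TopologicalSpace Filter

noncomputable section

namespace Buckling

/-- The partial derivative of `f` in the `i`-th coordinate direction at `x`. -/
def pderiv {d : ℕ} (i : Fin d) (f : EuclideanSpace ℝ (Fin d) → ℝ)
    (x : EuclideanSpace ℝ (Fin d)) : ℝ :=
  fderiv ℝ f x (EuclideanSpace.single i 1)

/-- The real Hilbert space `L²(Ω)`. -/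
abbrev L2 {d : ℕ} (Ω : Opens (EuclideanSpace ℝ (Fin d))) : Type :=
  Lp ℝ 2 (volume.restrict (Ω : Set (EuclideanSpace ℝ (Fin d))))

/-- Triples `(u, (gᵢ)ᵢ, (hᵢⱼ)ᵢⱼ)` of elements of `L²(Ω)`: a candidate for a function together with its
first and second order partial derivatives. -/
abbrev Jet {d : ℕ} (Ω : Opens (EuclideanSpace ℝ (Fin d))) : Type :=
  L2 Ω × (Fin d → L2 Ω) × (Fin d → Fin d → L2 Ω)

variable {d : ℕ} {Ω : Opens (EuclideanSpace ℝ (Fin d))}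

/-- The function `u` itself. -/
def val (u : Jet Ω) : L2 Ω := u.1

/-- The first order partial derivative `∂ᵢ u`. -/
def grad (u : Jet Ω) (i : Fin d) : L2 Ω := u.2.1 i

/-- The second order partial derivative `∂ᵢ ∂ⱼ u`. -/
def hess (u : Jet Ω) (i j : Fin d) : L2 Ω := u.2.2 i j

/-- The Laplacian `Δ u = ∑ᵢ ∂ᵢ ∂ᵢ u`. -/
def lap (u : Jet Ω) : L2 Ω := ∑ i, hess u i i

/-- `g` is the weak partial derivative of `f` in direction `i` on `Ω`:
`∫_Ω f ∂ᵢψ = - ∫_Ω g ψ` for all `ψ ∈ C_c^∞(Ω)`. -/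
def HasWeakPartial (i : Fin d) (f g : L2 Ω) : Prop :=
  ∀ ψ : TestFunction Ω ℝ (⊤ : ℕ∞),
    ∫ x in (Ω : Set (EuclideanSpace ℝ (Fin d))), f x * pderiv i ψ x =
      -∫ x in (Ω : Set (EuclideanSpace ℝ (Fin d))), g x * ψ x

/-- `u` is a test function `ψ ∈ C_c^∞(Ω)` together with its classical partial derivatives. -/
def IsTestJet (u : Jet Ω) : Prop :=
  ∃ ψ : TestFunction Ω ℝ (⊤ : ℕ∞),
    (val u =ᵐ[volume.restrict (Ω : Set (EuclideanSpace ℝ (Fin d)))] ψ) ∧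
    (∀ i, grad u i =ᵐ[volume.restrict (Ω : Set (EuclideanSpace ℝ (Fin d)))] pderiv i ψ) ∧
    (∀ i j, hess u i j =ᵐ[volume.restrict (Ω : Set (EuclideanSpace ℝ (Fin d)))]
      pderiv i (pderiv j ψ))

lemma contDiff_pderiv (i : Fin d) {f : EuclideanSpace ℝ (Fin d) → ℝ}
    (hf : ContDiff ℝ (⊤ : ℕ∞) f) : ContDiff ℝ (⊤ : ℕ∞) (pderiv i f) := by
  have h : ContDiff ℝ (⊤ : ℕ∞) (fderiv ℝ f) := hf.fderiv_right (by simp)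
  exact h.clm_apply contDiff_const

lemma hasCompactSupport_pderiv (i : Fin d) {f : EuclideanSpace ℝ (Fin d) → ℝ}
    (hf : HasCompactSupport f) : HasCompactSupport (pderiv i f) :=
  hf.fderiv_apply ℝ _

lemma pderiv_add (i : Fin d) {f g : EuclideanSpace ℝ (Fin d) → ℝ}
    (hf : ContDiff ℝ (⊤ : ℕ∞) f) (hg : ContDiff ℝ (⊤ : ℕ∞) g) :
    pderiv i (f + g) = pderiv i f + pderiv i g := by
  funext x
  simp [pderiv, fderiv_add (hf.differentiable (by simp) x) (hg.differentiable (by simp) x)]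

lemma pderiv_smul (i : Fin d) (c : ℝ) {f : EuclideanSpace ℝ (Fin d) → ℝ}
    (hf : ContDiff ℝ (⊤ : ℕ∞) f) : pderiv i (c • f) = c • pderiv i f := by
  funext x
  simp [pderiv, fderiv_const_smul (hf.differentiable (by simp) x)]

lemma integrable_mul_of_contDiff (f : L2 Ω) {ψ : EuclideanSpace ℝ (Fin d) → ℝ}
    (hψ : ContDiff ℝ (⊤ : ℕ∞) ψ) (hc : HasCompactSupport ψ) :
    Integrable (fun x => f x * ψ x)
      (volume.restrict (Ω : Set (EuclideanSpace ℝ (Fin d)))) := by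
  have h : MemLp ψ 2 (volume.restrict (Ω : Set (EuclideanSpace ℝ (Fin d)))) :=
    hψ.continuous.memLp_of_hasCompactSupport hc
  exact (Lp.memLp f).integrable_mul h

lemma integral_add_mul (f g : L2 Ω) {ψ : EuclideanSpace ℝ (Fin d) → ℝ}
    (hψ : ContDiff ℝ (⊤ : ℕ∞) ψ) (hc : HasCompactSupport ψ) :
    ∫ x in (Ω : Set (EuclideanSpace ℝ (Fin d))), (f + g : L2 Ω) x * ψ x =
      (∫ x in (Ω : Set (EuclideanSpace ℝ (Fin d))), f x * ψ x) +
        ∫ x in (Ω : Set (EuclideanSpace ℝ (Fin d))), g x * ψ x := by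
  rw [← integral_add (integrable_mul_of_contDiff f hψ hc) (integrable_mul_of_contDiff g hψ hc)]
  refine integral_congr_ae ?_
  filter_upwards [Lp.coeFn_add f g] with x hx
  rw [hx, Pi.add_apply, add_mul]

lemma integral_smul_mul (c : ℝ) (f : L2 Ω) (ψ : EuclideanSpace ℝ (Fin d) → ℝ) :
    ∫ x in (Ω : Set (EuclideanSpace ℝ (Fin d))), (c • f : L2 Ω) x * ψ x =
      c * ∫ x in (Ω : Set (EuclideanSpace ℝ (Fin d))), f x * ψ x := by
  rw [← integral_const_mul]
  refine integral_congr_ae ?_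
  filter_upwards [Lp.coeFn_smul c f] with x hx
  rw [hx, Pi.smul_apply, smul_eq_mul, mul_assoc]

lemma HasWeakPartial.zero (i : Fin d) : HasWeakPartial i (0 : L2 Ω) 0 := by
  intro ψ
  have h := fun χ => integral_smul_mul (Ω := Ω) 0 0 χ
  simp only [smul_zero, zero_mul] at h
  rw [h, h, neg_zero]

lemma HasWeakPartial.add {i : Fin d} {f g f' g' : L2 Ω} (h : HasWeakPartial i f g)
    (h' : HasWeakPartial i f' g') : HasWeakPartial i (f + f') (g + g') := by
  intro ψ
  rw [integral_add_mul _ _ (contDiff_pderiv i ψ.contDiff)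
    (hasCompactSupport_pderiv i ψ.hasCompactSupport),
    integral_add_mul _ _ ψ.contDiff ψ.hasCompactSupport, h ψ, h' ψ]
  ring

lemma HasWeakPartial.smul {i : Fin d} (c : ℝ) {f g : L2 Ω} (h : HasWeakPartial i f g) :
    HasWeakPartial i (c • f) (c • g) := by
  intro ψ
  rw [integral_smul_mul, integral_smul_mul, h ψ]
  ring

variable (Ω)

/-- The Sobolev space `H²(Ω)` of real functions in `L²(Ω)` whose weak partial derivatives up to
order two exist and belong to `L²(Ω)`. A function is stored with its (unique) weak derivatives. -/
def H2 : Submodule ℝ (Jet Ω) where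
  carrier := {u | (∀ i, HasWeakPartial i (val u) (grad u i)) ∧
    ∀ i j, HasWeakPartial i (grad u j) (hess u i j)}
  zero_mem' := ⟨fun i => HasWeakPartial.zero i, fun i _ => HasWeakPartial.zero i⟩
  add_mem' := fun hu hv => ⟨fun i => (hu.1 i).add (hv.1 i), fun i j => (hu.2 i j).add (hv.2 i j)⟩
  smul_mem' := fun c _ hu => ⟨fun i => (hu.1 i).smul c, fun i j => (hu.2 i j).smul c⟩

/-- The copy of `C_c^∞(Ω)` in the space of jets. -/
def testJets : Submodule ℝ (Jet Ω) where
  carrier := {u | IsTestJet u}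
  zero_mem' := by
    have h0 : ∀ i : Fin d, pderiv i (0 : EuclideanSpace ℝ (Fin d) → ℝ) = 0 := by
      intro i; funext x; simp [pderiv]
    refine ⟨0, ?_, fun i => ?_, fun i j => ?_⟩
    · exact Lp.coeFn_zero _ _ _
    · rw [FunLike.coe_zero, h0]; exact Lp.coeFn_zero _ _ _
    · rw [FunLike.coe_zero, h0, h0]; exact Lp.coeFn_zero _ _ _
  add_mem' := by
    rintro u v ⟨ψ, h, hg, hh⟩ ⟨χ, k, kg, kh⟩
    refine ⟨ψ + χ, ?_, fun i => ?_, fun i j => ?_⟩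
    · rw [FunLike.coe_add]
      exact (Lp.coeFn_add _ _).trans (h.add k)
    · rw [FunLike.coe_add, pderiv_add i ψ.contDiff χ.contDiff]
      exact (Lp.coeFn_add _ _).trans ((hg i).add (kg i))
    · rw [FunLike.coe_add, pderiv_add j ψ.contDiff χ.contDiff,
        pderiv_add i (contDiff_pderiv j ψ.contDiff) (contDiff_pderiv j χ.contDiff)]
      exact (Lp.coeFn_add _ _).trans ((hh i j).add (kh i j))
  smul_mem' := by
    rintro c u ⟨ψ, h, hg, hh⟩
    refine ⟨c • ψ, ?_, fun i => ?_, fun i j => ?_⟩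
    · rw [FunLike.coe_smul]
      exact (Lp.coeFn_smul _ _).trans (h.const_smul c)
    · rw [FunLike.coe_smul, pderiv_smul i c ψ.contDiff]
      exact (Lp.coeFn_smul _ _).trans ((hg i).const_smul c)
    · rw [FunLike.coe_smul, pderiv_smul j c ψ.contDiff,
        pderiv_smul i c (contDiff_pderiv j ψ.contDiff)]
      exact (Lp.coeFn_smul _ _).trans ((hh i j).const_smul c)

/-- The Sobolev space `H²₀(Ω)`: the closure of `C_c^∞(Ω)` in `H²(Ω)`. (The product topology on jets
induces the topology of the `H²`-norm.) -/
def H20 : Submodule ℝ (Jet Ω) := H2 Ω ⊓ (testJets Ω).topologicalClosure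

/-- The space of weak solutions `v ∈ H²₀(Ω)` of the buckling problem `Δ² v = - t Δ v`:
`∫_Ω Δv Δw = t ∫_Ω ∇v · ∇w` for all `w ∈ H²₀(Ω)`. The number `t` is an eigenvalue if and only if
this space is non-zero, and its dimension is then the multiplicity of `t`. -/
def eigenspace (t : ℝ) : Submodule ℝ (Jet Ω) where
  carrier := {v | v ∈ H20 Ω ∧ ∀ w ∈ H20 Ω,
    inner ℝ (lap v) (lap w) = t * ∑ i, inner ℝ (grad v i) (grad w i)}
  zero_mem' := ⟨zero_mem _, fun w _ => by simp [lap, hess, grad]⟩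
  add_mem' := by
    rintro u v ⟨hu, hu'⟩ ⟨hv, hv'⟩
    refine ⟨add_mem hu hv, fun w hw => ?_⟩
    have h1 : lap (u + v) = lap u + lap v := by simp [lap, hess, Finset.sum_add_distrib]
    have h2 : ∀ i, grad (u + v) i = grad u i + grad v i := fun _ => rfl
    simp only [h1, h2, inner_add_left, Finset.sum_add_distrib, mul_add, hu' w hw, hv' w hw]
  smul_mem' := by
    rintro c u ⟨hu, hu'⟩
    refine ⟨Submodule.smul_mem _ c hu, fun w hw => ?_⟩
    have h1 : lap (c • u) = c • lap u := by simp [lap, hess, Finset.smul_sum]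
    have h2 : ∀ i, grad (c • u) i = c • grad u i := fun _ => rfl
    simp only [h1, h2, real_inner_smul_left, ← Finset.mul_sum, hu' w hw]
    ring

/-- `σ 0 ≤ σ 1 ≤ ⋯` is the sequence of all buckling eigenvalues of `Ω`, each repeated according to
its (finite) multiplicity; all of them are positive and the sequence tends to `+∞`. -/
structure IsEigenvalueSequence (σ : ℕ → ℝ) : Prop where
  monotone : Monotone σ
  pos : ∀ j, 0 < σ j
  tendsto : Tendsto σ atTop atTop
  finiteDimensional : ∀ t : ℝ, FiniteDimensional ℝ (eigenspace Ω t)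
  multiplicity : ∀ t : ℝ, Module.finrank ℝ (eigenspace Ω t) = {j : ℕ | σ j = t}.ncard

end Buckling

end

/-! Spectrum. On `H20 Ω` the Laplacian controls the full jet: `‖∇u‖² ≤ ‖u‖ ‖Δu‖` by Green's formula,
`‖D²u‖ = ‖Δu‖` by two integrations by parts, and finite volume gives a Poincaré inequality. Hence
`Δ` is injective with closed range `K` in `L²(Ω)`, and `⟨∇u, ∇w⟩ = ⟨T Δu, Δw⟩` defines a positive
operator `T` on `K`. It is compact because a function orthogonal to finitely many suitable plane
waves has small low frequencies, while its gradient controls the high ones (`exists_finite_small`).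
Buckling eigenvalues are the reciprocals of the eigenvalues of `T`, so the spectral theorem yields
the sequence (`exists_bucklingOperator`, `exists_isRecipSpectrum`).

Inequality. Let `b j = Δv_j` be an orthonormal eigenbasis of `K`. For `f` in `H20 Ω`, expanding in
this basis and dropping negative terms gives `z ‖∇f‖² - ‖Δf‖² ≤ ∑ (z - σ_j)₊ σ_j ⟨∇f, ∇v_j⟩²`, and
`⟨∇f, ∇v_j⟩ = -⟨f, b j⟩` (`IsRecipSpectrum.quadratic_bound`, `sum_inner_grad_eq`). Apply this to the
real and imaginary parts of `f = φ exp(i⟨ξ,x⟩)`. On the right appears the squared Fourier transform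
of `φ b j` at `ξ`, whose integral over all `ξ` is `(2π)^d ‖φ b j‖² ≤ (2π)^d ‖φ‖_∞²` by Plancherel.
On the left appears an explicit polynomial in `ξ` (`quadratic_waveJet`), whose integral over `|ξ|² ≤
z` is the stated bound (`setIntegral_symbol`). -/

noncomputable section

namespace Buckling

/-! ### Orders of type `ℕ`. -/

section OrderNat

/-- The isomorphism is the inverse of the rank, the number of strict predecessors. The ranks form an
initial segment of `ℕ`, and an infinite one since the rank is injective. -/
lemma nonempty_orderIso_nat {ι : Type*} [LinearOrder ι] [Infinite ι]
    (h : ∀ i : ι, (Set.Iic i).Finite) : Nonempty (ℕ ≃o ι) := by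
  classical
  let rank : ι → ℕ := fun i => (Set.Iio i).ncard
  have hfin : ∀ i : ι, (Set.Iio i).Finite := fun i => (h i).subset Set.Iio_subset_Iic_self
  have hmono : StrictMono rank := by
    intro i j hij
    refine Set.ncard_lt_ncard ?_ (hfin j)
    exact ⟨Set.Iio_subset_Iio hij.le, fun hh => lt_irrefl i (hh hij)⟩
  have hlower : ∀ i n, n < rank i → ∃ j, rank j = n := by
    intro i
    have hwf : WellFoundedLT ι := ⟨(measure rank).wf.mono fun a b hab => hmono hab⟩
    induction i using WellFoundedLT.induction with
    | _ i ih =>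
      intro n hn
      have hne : (hfin i).toFinset.Nonempty := by
        rw [Set.Finite.toFinset_nonempty, ← Set.ncard_pos (hfin i)]
        exact lt_of_le_of_lt (Nat.zero_le n) hn
      -- The immediate predecessor of `i`, whose rank is one less.
      let p := (hfin i).toFinset.max' hne
      have hp : p < i := (hfin i).mem_toFinset.1 ((hfin i).toFinset.max'_mem hne)
      have hIio : Set.Iio i = insert p (Set.Iio p) := by
        ext x
        simp only [Set.mem_Iio, Set.mem_insert_iff]
        constructor
        · intro hx
          exact ((hfin i).toFinset.le_max' x (by simpa using hx)).eq_or_lt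
        · rintro (rfl | hx)
          · exact hp
          · exact hx.trans hp
      have hr : rank i = rank p + 1 := by
        change (Set.Iio i).ncard = _
        rw [hIio, Set.ncard_insert_of_notMem (by simp) (hfin p)]
      rcases Nat.lt_succ_iff_lt_or_eq.1 (hr ▸ hn) with h1 | h1
      · exact ih p hp n h1
      · exact ⟨p, h1.symm⟩
  have hsurj : Function.Surjective rank := by
    intro n
    by_contra hcon
    have hle : ∀ i, rank i < n := fun i => by
      by_contra! h1
      rcases h1.eq_or_lt with h2 | h2
      · exact hcon ⟨i, h2.symm⟩
      · exact hcon (hlower i n h2)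
    have : Finite ι := Finite.of_injective (fun i => (⟨rank i, hle i⟩ : Fin n))
      fun a b hab => hmono.injective (by simpa using hab)
    exact not_finite ι
  exact ⟨(StrictMono.orderIsoOfSurjective rank hmono hsurj).symm⟩

end OrderNat

/-! ### Spectral theory of a compact positive operator, in terms of reciprocal eigenvalues. -/

section Spectral

variable {H : Type*} [NormedAddCommGroup H] [InnerProductSpace ℝ H]

/-- The eigenspace of `T` for the eigenvalue `1 / t` (and the zero space if `t = 0`). -/
def recipEigenspace (T : H →L[ℝ] H) (t : ℝ) : Submodule ℝ H :=
  LinearMap.ker (LinearMap.id - t • (T : H →ₗ[ℝ] H))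

variable {T : H →L[ℝ] H}

lemma mem_recipEigenspace {t : ℝ} {x : H} : x ∈ recipEigenspace T t ↔ t • T x = x := by
  rw [recipEigenspace, LinearMap.mem_ker]
  simp [sub_eq_zero, eq_comm (a := x)]

lemma recipEigenspace_zero : recipEigenspace T 0 = ⊥ := by
  ext x; simp [mem_recipEigenspace, eq_comm]

lemma recipEigenspace_eq {t : ℝ} (ht : t ≠ 0) :
    recipEigenspace T t = Module.End.eigenspace (T : Module.End ℝ H) t⁻¹ := by
  ext x
  rw [mem_recipEigenspace, Module.End.mem_eigenspace_iff]
  constructor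
  · intro h; nth_rewrite 2 [← h]; rw [smul_smul, inv_mul_cancel₀ ht, one_smul]; rfl
  · intro h
    have h' : T x = t⁻¹ • x := h
    rw [h', smul_smul, mul_inv_cancel₀ ht, one_smul]

lemma recipEigenspace_eq_bot (hpos : ∀ x, x ≠ 0 → 0 < inner ℝ (T x) x) {t : ℝ} (ht : t ≤ 0) :
    recipEigenspace T t = ⊥ := by
  rw [eq_bot_iff]
  intro x hx
  rw [mem_recipEigenspace] at hx
  by_contra h
  have h0 : x ≠ 0 := by simpa using h
  have h1 : inner ℝ x x = t * inner ℝ (T x) x := by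
    nth_rewrite 1 [← hx]; rw [real_inner_smul_left]
  have h2 : 0 < inner ℝ x x := real_inner_self_pos.2 h0
  nlinarith [hpos x h0]

lemma inner_recipEigenspace (hs : T.IsSymmetric) {s t : ℝ} (hst : s ≠ t) {x y : H}
    (hx : x ∈ recipEigenspace T s) (hy : y ∈ recipEigenspace T t) : inner ℝ x y = 0 := by
  rw [mem_recipEigenspace] at hx hy
  have h1 : inner ℝ x y = s * inner ℝ x (T y) := by
    nth_rewrite 1 [← hx]; rw [real_inner_smul_left]; congr 1; exact hs x y
  have h2 : inner ℝ x y = t * inner ℝ x (T y) := by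
    nth_rewrite 1 [← hy]; rw [real_inner_smul_right]
  have h3 : (s - t) * inner ℝ x (T y) = 0 := by rw [sub_mul]; linarith
  rcases mul_eq_zero.1 h3 with h | h
  · exact absurd (sub_eq_zero.1 h) hst
  · rw [h1, h, mul_zero]

variable [CompleteSpace H]

lemma finiteDimensional_recipEigenspace (hc : IsCompactOperator T) (t : ℝ) :
    FiniteDimensional ℝ (recipEigenspace T t) := by
  by_cases ht : t = 0
  · subst ht; rw [recipEigenspace_zero]; infer_instance
  · rw [recipEigenspace_eq ht]
    exact ContinuousLinearMap.finite_dimensional_eigenspace hc _ (inv_ne_zero ht)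

/-- Strict positivity makes the kernel of `T` trivial, so the eigenvalues having a reciprocal
already exhaust the spectral theorem. -/
lemma iSup_recipEigenspace_orthogonal (hc : IsCompactOperator T) (hs : T.IsSymmetric)
    (hpos : ∀ x, x ≠ 0 → 0 < inner ℝ (T x) x) : (⨆ t, recipEigenspace T t)ᗮ = ⊥ := by
  rw [eq_bot_iff, ← ContinuousLinearMap.orthogonalComplement_iSup_eigenspaces_eq_bot hc hs]
  refine Submodule.orthogonal_le (iSup_le fun μ => ?_)
  by_cases hμ : μ = 0
  · intro x hx
    rw [hμ, Module.End.mem_eigenspace_iff, zero_smul] at hx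
    have : x = 0 := by
      by_contra h
      have := hpos x h
      rw [show T x = 0 from hx, inner_zero_left] at this
      exact lt_irrefl _ this
    rw [this]; exact zero_mem _
  · have := recipEigenspace_eq (T := T) (inv_ne_zero hμ)
    rw [inv_inv] at this
    rw [← this]
    exact le_iSup (recipEigenspace T) μ⁻¹

-- Distinct images satisfy `‖T e_m - T e_n‖² = t_m⁻² + t_n⁻² ≥ 2 z⁻²`, so `T e_n` has no Cauchy
-- subsequence. This is what forces the eigenvalue sequence to tend to infinity.
omit [CompleteSpace H] in
lemma not_bounded_of_orthonormal (hc : IsCompactOperator T) {e : ℕ → H} (he : Orthonormal ℝ e)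
    {t : ℕ → ℝ} (het : ∀ n, e n ∈ recipEigenspace T (t n)) {z : ℝ} (hz : ∀ n, t n ≤ z)
    (ht : ∀ n, 0 < t n) : False := by
  have hT : ∀ n, T (e n) = (t n)⁻¹ • e n := fun n => by
    have h := mem_recipEigenspace.1 (het n)
    nth_rewrite 2 [← h]
    rw [smul_smul, inv_mul_cancel₀ (ht n).ne', one_smul]
  have hz0 : 0 < z := (ht 0).trans_le (hz 0)
  obtain ⟨K, hK, hsub⟩ := hc.image_closedBall_subset_compact (f := (T : H →ₗ[ℝ] H)) 1
  have hmem : ∀ n, T (e n) ∈ K := fun n => hsub ⟨e n, by simp [he.1 n], rfl⟩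
  obtain ⟨a, -, φ, hφ, hlim⟩ := hK.tendsto_subseq hmem
  have hcau := hlim.cauchySeq
  rw [Metric.cauchySeq_iff'] at hcau
  obtain ⟨N, hN⟩ := hcau z⁻¹ (inv_pos.2 hz0)
  have h1 := hN (N + 1) (Nat.le_succ N)
  have hne : φ (N + 1) ≠ φ N := (hφ (Nat.lt_succ_self N)).ne'
  have h2 : ‖T (e (φ (N + 1))) - T (e (φ N))‖ ^ 2 = (t (φ (N + 1)))⁻¹ ^ 2 + (t (φ N))⁻¹ ^ 2 := by
    rw [hT, hT, norm_sub_sq_real, real_inner_smul_left, real_inner_smul_right, he.2 hne,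
      norm_smul, norm_smul, he.1, he.1]
    simp
  have h3 : z⁻¹ ≤ (t (φ N))⁻¹ := inv_anti₀ (ht _) (hz _)
  have h4 : ‖T (e (φ (N + 1))) - T (e (φ N))‖ < z⁻¹ := by
    simpa [dist_eq_norm] using h1
  have h5 : 0 < z⁻¹ := inv_pos.2 hz0
  nlinarith [norm_nonneg (T (e (φ (N + 1))) - T (e (φ N))), sq_nonneg (t (φ (N + 1)))⁻¹]

/-- `σ 0 ≤ σ 1 ≤ ⋯` are the reciprocals of the eigenvalues of `T`, repeated by multiplicity. -/
structure IsRecipSpectrum (T : H →L[ℝ] H) (σ : ℕ → ℝ) : Prop where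
  monotone : Monotone σ
  pos : ∀ j, 0 < σ j
  tendsto : Tendsto σ atTop atTop
  multiplicity : ∀ t : ℝ, Module.finrank ℝ (recipEigenspace T t) = {j : ℕ | σ j = t}.ncard

lemma exists_isRecipSpectrum (hinf : ¬ FiniteDimensional ℝ H) (hc : IsCompactOperator T)
    (hs : T.IsSymmetric) (hpos : ∀ x, x ≠ 0 → 0 < inner ℝ (T x) x) :
    ∃ σ : ℕ → ℝ, IsRecipSpectrum T σ := by
  classical
  have hfd := finiteDimensional_recipEigenspace hc
  -- One index per vector of an orthonormal basis of each eigenspace. The lexicographic order sorts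
  -- by `t` first, so an order isomorphism with `ℕ` lists the values increasingly, with
  -- multiplicity.
  let I := Σₗ (t : ℝ), Fin (Module.finrank ℝ (recipEigenspace T t))
  let val : I → ℝ := fun i => (ofLex i).1
  let e : I → H := fun i => (stdOrthonormalBasis ℝ (recipEigenspace T (ofLex i).1) (ofLex i).2 : H)
  have hmem : ∀ i, e i ∈ recipEigenspace T (val i) := fun i => Subtype.coe_prop _
  have hval : ∀ i : I, 0 < val i := by
    intro i
    by_contra! h
    have h1 : Module.finrank ℝ (recipEigenspace T (val i)) = 0 := by
      rw [recipEigenspace_eq_bot hpos h]; simp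
    have h2 := (ofLex i).2.2
    have h3 : ((ofLex i).2 : ℕ) < Module.finrank ℝ (recipEigenspace T (val i)) := h2
    omega
  have he : Orthonormal ℝ e := by
    constructor
    · intro i
      exact (stdOrthonormalBasis ℝ (recipEigenspace T (ofLex i).1)).orthonormal.1 (ofLex i).2
    · rintro ⟨s, i⟩ ⟨t, j⟩ hij
      by_cases hst : s = t
      · subst hst
        have hne : i ≠ j := fun h => hij (by rw [h])
        exact (stdOrthonormalBasis ℝ (recipEigenspace T s)).orthonormal.2 hne
      · exact inner_recipEigenspace hs hst (hmem ⟨s, i⟩) (hmem ⟨t, j⟩)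
  have hfin : ∀ z : ℝ, {i : I | val i ≤ z}.Finite := by
    intro z
    by_contra h
    have hi : Infinite {i : I | val i ≤ z} := Set.infinite_coe_iff.2 h
    let f := Infinite.natEmbedding {i : I | val i ≤ z}
    refine not_bounded_of_orthonormal hc (e := fun n => e (f n))
      (he.comp _ (Subtype.val_injective.comp f.injective)) (t := fun n => val (f n))
      (fun n => hmem _) (z := z) (fun n => (f n).2) (fun n => hval _)
  have hI : Infinite I := by
    by_contra h
    have hfI : Finite I := not_infinite_iff_finite.1 h
    apply hinf
    -- If `I` were finite, this span would be closed with trivial orthogonal complement, hence the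
    -- whole space.
    let V := Submodule.span ℝ (Set.range e)
    have : FiniteDimensional ℝ V := FiniteDimensional.span_of_finite ℝ (Set.finite_range e)
    have hV : V = ⊤ := by
      rw [← Submodule.orthogonal_eq_bot_iff, eq_bot_iff,
        ← iSup_recipEigenspace_orthogonal hc hs hpos]
      refine Submodule.orthogonal_le (iSup_le fun t x hx => ?_)
      have h1 := (stdOrthonormalBasis ℝ (recipEigenspace T t)).sum_repr ⟨x, hx⟩
      have h2 := congrArg (Subtype.val) h1
      rw [← show _ = x from h2]
      rw [Submodule.coe_sum]
      refine Submodule.sum_mem _ fun i _ => ?_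
      rw [Submodule.coe_smul]
      exact Submodule.smul_mem _ _ (Submodule.subset_span ⟨(⟨t, i⟩ : I), rfl⟩)
    have : FiniteDimensional ℝ (⊤ : Submodule ℝ H) := hV ▸ this
    exact Module.Finite.equiv (Submodule.topEquiv (R := ℝ) (M := H))
  have hvm : Monotone val := by
    intro i j hij
    rcases (Sigma.Lex.le_def).1 hij with h | ⟨h, -⟩
    · exact h.le
    · exact h.le
  obtain ⟨f⟩ := nonempty_orderIso_nat (ι := I) fun i =>
    (hfin (val i)).subset fun j hj => hvm hj
  refine ⟨fun n => val (f n), hvm.comp f.monotone, fun j => hval _, ?_, fun t => ?_⟩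
  · rw [tendsto_atTop]
    intro z
    have h : {n | val (f n) ≤ z}.Finite := (hfin z).preimage f.injective.injOn
    rw [← Nat.cofinite_eq_atTop]
    filter_upwards [h.compl_mem_cofinite] with n hn
    exact (not_le.1 (Set.notMem_ofPred_iff.1 hn)).le
  · have h1 : {j : ℕ | val (f j) = t}.ncard = {i : I | val i = t}.ncard := by
      rw [← Set.ncard_image_of_injective _ f.injective]
      congr 1
      ext i
      constructor
      · rintro ⟨n, hn, rfl⟩; exact hn
      · intro hi; exact ⟨f.symm i, by simpa using hi, by simp⟩
    rw [h1]
    let g : Fin (Module.finrank ℝ (recipEigenspace T t)) → I := fun i => toLex ⟨t, i⟩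
    have h2 : {i : I | val i = t} = Set.range g := by
      ext i
      constructor
      · rcases i with ⟨s, i⟩
        rintro h
        have h' : s = t := h
        subst h'
        exact ⟨i, rfl⟩
      · rintro ⟨i, rfl⟩; rfl
    rw [h2, ← Nat.card_coe_set_eq, Nat.card_range_of_injective]
    · simp
    · intro i j hij
      simpa [g] using hij

/-- The final inequality concerns an arbitrary eigenvalue sequence, so the basis is built from `σ`:
the multiplicity condition matches the indices `j` with `σ j = t` to a basis of the eigenspace for
`t`. -/
lemma IsRecipSpectrum.exists_hilbertBasis {σ : ℕ → ℝ} (hσ : IsRecipSpectrum T σ)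
    (hc : IsCompactOperator T) (hs : T.IsSymmetric)
    (hpos : ∀ x, x ≠ 0 → 0 < inner ℝ (T x) x) :
    ∃ b : HilbertBasis ℕ ℝ H, ∀ j, σ j • T (b j) = b j := by
  classical
  have hfd := finiteDimensional_recipEigenspace hc
  have hfin : ∀ t, {j | σ j = t}.Finite := fun t => by
    have h := (tendsto_atTop.1 hσ.tendsto (t + 1))
    rw [← Nat.cofinite_eq_atTop] at h
    refine Set.Finite.subset h ?_
    rintro j rfl
    simp
  have hι : ∀ t, Nonempty ({j | σ j = t} ≃ Fin (Module.finrank ℝ (recipEigenspace T t))) := fun t => by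
    have := (hfin t).to_subtype
    refine ⟨Finite.equivFinOfCardEq ?_⟩
    rw [Nat.card_coe_set_eq, hσ.multiplicity t]
  let ι := fun t => (hι t).some
  let v : ℕ → H := fun j => stdOrthonormalBasis ℝ (recipEigenspace T (σ j)) (ι (σ j) ⟨j, rfl⟩)
  have hmem : ∀ j, v j ∈ recipEigenspace T (σ j) := fun j => Subtype.coe_prop _
  have hvt : ∀ t j (h : σ j = t), v j = stdOrthonormalBasis ℝ (recipEigenspace T t) (ι t ⟨j, h⟩) := by
    rintro t j rfl; rfl
  have hv : Orthonormal ℝ v := by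
    refine ⟨fun j => (stdOrthonormalBasis ℝ (recipEigenspace T (σ j))).orthonormal.1 _, ?_⟩
    intro i j hij
    by_cases h : σ i = σ j
    · rw [hvt _ i h, hvt _ j rfl]
      refine (stdOrthonormalBasis ℝ (recipEigenspace T (σ j))).orthonormal.2 fun h' => hij ?_
      simpa using h'
    · exact inner_recipEigenspace hs h (hmem i) (hmem j)
  have hspan : (Submodule.span ℝ (Set.range v))ᗮ = ⊥ := by
    rw [eq_bot_iff, ← iSup_recipEigenspace_orthogonal hc hs hpos]
    refine Submodule.orthogonal_le (iSup_le fun t x hx => ?_)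
    have h1 := (stdOrthonormalBasis ℝ (recipEigenspace T t)).sum_repr ⟨x, hx⟩
    rw [← show _ = x from congrArg Subtype.val h1, Submodule.coe_sum]
    refine Submodule.sum_mem _ fun i _ => ?_
    rw [Submodule.coe_smul]
    refine Submodule.smul_mem _ _ (Submodule.subset_span ⟨((ι t).symm i : ℕ), ?_⟩)
    rw [hvt t _ ((ι t).symm i).2]
    simp
  refine ⟨HilbertBasis.mkOfOrthogonalEqBot hv hspan, fun j => ?_⟩
  rw [HilbertBasis.coe_mkOfOrthogonalEqBot]
  exact mem_recipEigenspace.1 (hmem j)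

omit [CompleteSpace H] in
/-- The convexity (Berezin-Li-Yau type) bound in an eigenbasis of `T`. -/
lemma IsRecipSpectrum.quadratic_bound {σ : ℕ → ℝ} (hσ : IsRecipSpectrum T σ) (hs : T.IsSymmetric)
    (b : HilbertBasis ℕ ℝ H) (hb : ∀ j, σ j • T (b j) = b j) (z : ℝ) (x : H) {s : Finset ℕ}
    (hz : ∀ j ∉ s, z ≤ σ j) :
    z * inner ℝ (T x) x - ‖x‖ ^ 2 ≤
      ∑ j ∈ s, max (z - σ j) 0 * σ j * inner ℝ (T x) (b j) ^ 2 := by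
  have hTb : ∀ j, inner ℝ (T x) (b j) = (σ j)⁻¹ * inner ℝ x (b j) := fun j => by
    have h := hb j
    have h1 : inner ℝ (T x) (b j) = inner ℝ x (T (b j)) := hs x (b j)
    rw [h1]
    nth_rewrite 2 [← h]
    rw [real_inner_smul_right, ← mul_assoc, inv_mul_cancel₀ (hσ.pos j).ne', one_mul]
  -- Parseval for both terms. By `hTb` the `j`-th summand equals `(z - σ j) * (σ j)⁻¹ * ⟨x, b j⟩²`;
  -- outside `s` it is nonpositive and can be dropped.
  have h1 : HasSum (fun j => z * (inner ℝ (T x) (b j) * inner ℝ (b j) x) -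
      inner ℝ x (b j) * inner ℝ (b j) x) (z * inner ℝ (T x) x - ‖x‖ ^ 2) := by
    rw [← real_inner_self_eq_norm_sq]
    exact ((b.hasSum_inner_mul_inner (T x) x).mul_left z).sub (b.hasSum_inner_mul_inner x x)
  have h2 : HasSum (fun j => if j ∈ s then max (z - σ j) 0 * σ j * inner ℝ (T x) (b j) ^ 2 else 0)
      (∑ j ∈ s, max (z - σ j) 0 * σ j * inner ℝ (T x) (b j) ^ 2) := by
    have := hasSum_sum_of_ne_finset_zero (s := s) (L := SummationFilter.unconditional ℕ)
      (f := fun j => if j ∈ s then max (z - σ j) 0 * σ j * inner ℝ (T x) (b j) ^ 2 else 0)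
      fun j hj => if_neg hj
    convert! this using 1
    exact Finset.sum_congr rfl fun j hj => (if_pos hj).symm
  refine hasSum_le (fun j => ?_) h1 h2
  have hp := hσ.pos j
  have key : z * (inner ℝ (T x) (b j) * inner ℝ (b j) x) - inner ℝ x (b j) * inner ℝ (b j) x =
      (z - σ j) * ((σ j)⁻¹ * inner ℝ x (b j) ^ 2) := by
    rw [hTb, real_inner_comm x (b j)]
    field_simp
  have hnn : 0 ≤ (σ j)⁻¹ * inner ℝ x (b j) ^ 2 := by positivity
  rw [key]
  split_ifs with h
  · rw [hTb]
    calc (z - σ j) * ((σ j)⁻¹ * inner ℝ x (b j) ^ 2)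
        ≤ max (z - σ j) 0 * ((σ j)⁻¹ * inner ℝ x (b j) ^ 2) :=
          mul_le_mul_of_nonneg_right (le_max_left _ _) hnn
      _ = _ := by field_simp
  · exact mul_nonpos_of_nonpos_of_nonneg (sub_nonpos.2 (hz j h)) hnn

end Spectral

/-! ### A compactness criterion. -/

section Compactness

variable {H F : Type*} [NormedAddCommGroup H] [InnerProductSpace ℝ H]
  [NormedAddCommGroup F] [NormedSpace ℝ F] [CompleteSpace F]

/-- A bounded operator that is small on subspaces of finite codimension is compact. -/
lemma isCompactOperator_of_small (G : H →L[ℝ] F)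
    (h : ∀ ε > 0, ∃ V : Submodule ℝ H, FiniteDimensional ℝ V ∧ ∀ x ∈ Vᗮ, ‖G x‖ ≤ ε * ‖x‖) :
    IsCompactOperator G := by
  have hpos : ∀ n : ℕ, (0 : ℝ) < 1 / ((n : ℝ) + 1) := fun n => by positivity
  choose V hV hG using fun n : ℕ => h _ (hpos n)
  have : ∀ n, FiniteDimensional ℝ (V n) := hV
  -- `G` composed with the projection onto `V n` has finite rank, and differs from `G` by `G` on `(V
  -- n)ᗮ`, of norm at most `1 / (n + 1)`.
  refine isCompactOperator_of_tendsto (l := atTop)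
    (F := fun n : ℕ => G ∘L (V n).starProjection) ?_ ?_
  · rw [tendsto_iff_norm_sub_tendsto_zero]
    refine squeeze_zero (fun n => norm_nonneg _) (fun n => ?_)
      tendsto_one_div_add_atTop_nhds_zero_nat
    refine ContinuousLinearMap.opNorm_le_bound _ (hpos n).le fun x => ?_
    have h1 : x - (V n).starProjection x = (V n)ᗮ.starProjection x :=
      (Submodule.starProjection_orthogonal_val x).symm
    have h2 := hG n _ (Submodule.starProjection_apply_mem (V n)ᗮ x)
    have h3 : ‖(V n)ᗮ.starProjection x‖ ≤ ‖x‖ := Submodule.norm_starProjection_apply_le _ x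
    rw [sub_apply, ← norm_neg, neg_sub, ContinuousLinearMap.comp_apply, ← map_sub, h1]
    exact h2.trans (mul_le_mul_of_nonneg_left h3 (hpos n).le)
  · refine Eventually.of_forall fun n => ?_
    have h1 : IsCompactOperator (V n).orthogonalProjectionOnto :=
      have : ProperSpace (V n) := FiniteDimensional.proper ℝ _
      isCompactOperator_of_locallyCompactSpace_dom (V n).orthogonalProjectionOnto
    exact h1.clm_comp (G ∘L (V n).subtypeL)

end Compactness

variable {d : ℕ} {Ω : Opens (EuclideanSpace ℝ (Fin d))}

/-! ### Continuity of the jet components. -/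

section Continuity

lemma continuous_val : Continuous (val : Jet Ω → L2 Ω) := continuous_fst

lemma continuous_grad (i : Fin d) : Continuous (fun u : Jet Ω => grad u i) :=
  (continuous_apply i).comp (continuous_fst.comp continuous_snd)

lemma continuous_hess (i j : Fin d) : Continuous (fun u : Jet Ω => hess u i j) :=
  (continuous_apply j).comp ((continuous_apply i).comp (continuous_snd.comp continuous_snd))

lemma continuous_lap : Continuous (lap : Jet Ω → L2 Ω) :=
  continuous_finsetSum _ fun i _ => continuous_hess i i

lemma lap_add (u v : Jet Ω) : lap (u + v) = lap u + lap v := by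
  simp [lap, hess, Finset.sum_add_distrib]

lemma lap_smul (c : ℝ) (u : Jet Ω) : lap (c • u) = c • lap u := by
  simp [lap, hess, Finset.smul_sum]

end Continuity

/-! ### Test functions and integration by parts in `H²₀(Ω)`. -/

section TestJet

lemma memLp_test (ψ : TestFunction Ω ℝ (⊤ : ℕ∞)) :
    MemLp ψ 2 (volume.restrict (Ω : Set (EuclideanSpace ℝ (Fin d)))) :=
  ψ.continuous.memLp_of_hasCompactSupport ψ.hasCompactSupport

/-- The partial derivative of a test function. -/
def testPderiv (i : Fin d) (ψ : TestFunction Ω ℝ (⊤ : ℕ∞)) : TestFunction Ω ℝ (⊤ : ℕ∞) where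
  toFun := pderiv i ψ
  contDiff' := contDiff_pderiv i ψ.contDiff
  hasCompactSupport' := hasCompactSupport_pderiv i ψ.hasCompactSupport
  tsupport_subset' := (tsupport_fderiv_apply_subset ℝ _).trans ψ.tsupport_subset

@[simp] lemma coe_testPderiv (i : Fin d) (ψ : TestFunction Ω ℝ (⊤ : ℕ∞)) :
    ⇑(testPderiv i ψ) = pderiv i ψ := rfl

/-- The class of a test function in `L²(Ω)`. -/
def testL2 (ψ : TestFunction Ω ℝ (⊤ : ℕ∞)) : L2 Ω := (memLp_test ψ).toLp ψ

lemma coeFn_testL2 (ψ : TestFunction Ω ℝ (⊤ : ℕ∞)) :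
    testL2 ψ =ᵐ[volume.restrict (Ω : Set (EuclideanSpace ℝ (Fin d)))] ψ := MemLp.coeFn_toLp _

/-- A test function with its derivatives. -/
def testJet (ψ : TestFunction Ω ℝ (⊤ : ℕ∞)) : Jet Ω :=
  (testL2 ψ, fun i => testL2 (testPderiv i ψ), fun i j => testL2 (testPderiv i (testPderiv j ψ)))

lemma testJet_mem (ψ : TestFunction Ω ℝ (⊤ : ℕ∞)) : testJet ψ ∈ testJets Ω :=
  ⟨ψ, coeFn_testL2 _, fun _ => coeFn_testL2 _, fun _ _ => coeFn_testL2 _⟩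

lemma mem_testJets_iff {u : Jet Ω} : u ∈ testJets Ω ↔ ∃ ψ, u = testJet ψ := by
  constructor
  · rintro ⟨ψ, h, hg, hh⟩
    refine ⟨ψ, Prod.ext ?_ (Prod.ext (funext fun i => ?_) (funext fun i => funext fun j => ?_))⟩
    · exact Lp.ext (h.trans (coeFn_testL2 _).symm)
    · exact Lp.ext ((hg i).trans (coeFn_testL2 (testPderiv i ψ)).symm)
    · exact Lp.ext ((hh i j).trans (coeFn_testL2 (testPderiv i (testPderiv j ψ))).symm)
  · rintro ⟨ψ, rfl⟩
    exact testJet_mem ψ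

lemma integral_mul_test (f : L2 Ω) (ψ : TestFunction Ω ℝ (⊤ : ℕ∞)) :
    ∫ x in (Ω : Set (EuclideanSpace ℝ (Fin d))), f x * ψ x = inner ℝ f (testL2 ψ) := by
  rw [L2.inner_def]
  refine integral_congr_ae ?_
  filter_upwards [coeFn_testL2 ψ] with x hx
  rw [hx]
  simp [mul_comm]

lemma hasWeakPartial_iff {i : Fin d} {f g : L2 Ω} :
    HasWeakPartial i f g ↔ ∀ ψ : TestFunction Ω ℝ (⊤ : ℕ∞),
      inner ℝ f (testL2 (testPderiv i ψ)) = -inner ℝ g (testL2 ψ) := by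
  refine forall_congr' fun ψ => ?_
  rw [← integral_mul_test, ← integral_mul_test]
  rfl

lemma inner_testL2_pderiv (i : Fin d) (ψ χ : TestFunction Ω ℝ (⊤ : ℕ∞)) :
    inner ℝ (testL2 χ) (testL2 (testPderiv i ψ)) = -inner ℝ (testL2 (testPderiv i χ)) (testL2 ψ) := by
  have h : ∀ f g : TestFunction Ω ℝ (⊤ : ℕ∞),
      inner ℝ (testL2 f) (testL2 g) = ∫ x, f x * g x := fun f g => by
    rw [← integral_mul_test, ← setIntegral_eq_integral_of_forall_compl_eq_zero
      (s := (Ω : Set (EuclideanSpace ℝ (Fin d)))) (f := fun x => f x * g x)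
      fun x hx => by
        rw [image_eq_zero_of_notMem_tsupport fun hh => hx (f.tsupport_subset hh), zero_mul]]
    refine integral_congr_ae ?_
    filter_upwards [coeFn_testL2 f] with x hx
    rw [hx]
  have hint : ∀ f g : TestFunction Ω ℝ (⊤ : ℕ∞), Integrable fun x => f x * g x := fun f g =>
    (f.continuous.mul g.continuous).integrable_of_hasCompactSupport f.hasCompactSupport.mul_right
  rw [h, h]
  exact integral_mul_fderiv_eq_neg_fderiv_mul_of_integrable
    (hint (testPderiv i χ) ψ) (hint χ (testPderiv i ψ)) (hint χ ψ)
    (fun x _ => χ.contDiff.differentiable (by simp) x)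
    (fun x _ => ψ.contDiff.differentiable (by simp) x)

lemma testJets_le_H2 : testJets Ω ≤ H2 Ω := by
  intro u hu
  obtain ⟨ψ, rfl⟩ := mem_testJets_iff.1 hu
  exact ⟨fun i => hasWeakPartial_iff.2 fun χ => inner_testL2_pderiv i χ ψ,
    fun i j => hasWeakPartial_iff.2 fun χ => inner_testL2_pderiv i χ (testPderiv j ψ)⟩

lemma isClosed_H2 : IsClosed (H2 Ω : Set (Jet Ω)) := by
  have h : (H2 Ω : Set (Jet Ω)) =
      (⋂ i, {u | HasWeakPartial i (val u) (grad u i)}) ∩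
      ⋂ i, ⋂ j, {u | HasWeakPartial i (grad u j) (hess u i j)} := by
    ext u
    simp only [Set.mem_inter_iff, Set.mem_iInter]
    rfl
  have key : ∀ (i : Fin d) (f g : Jet Ω → L2 Ω), Continuous f → Continuous g →
      IsClosed {u | HasWeakPartial i (f u) (g u)} := by
    intro i f g hf hg
    simp only [hasWeakPartial_iff, Set.ofPred_forall]
    exact isClosed_iInter fun ψ => isClosed_eq (hf.inner continuous_const)
      (hg.inner continuous_const).neg
  rw [h]
  exact (isClosed_iInter fun i => key i _ _ continuous_val (continuous_grad i)).inter
    (isClosed_iInter fun i => isClosed_iInter fun j => key i _ _ (continuous_grad j)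
      (continuous_hess i j))

/-- Weak differentiability is a closed condition satisfied by test functions, so the closure in the
space of jets stays inside `H2 Ω`. -/
lemma H20_eq : H20 Ω = (testJets Ω).topologicalClosure :=
  inf_eq_right.2 (Submodule.topologicalClosure_minimal _ testJets_le_H2 isClosed_H2)

lemma isClosed_H20 : IsClosed (H20 Ω : Set (Jet Ω)) := by
  rw [H20_eq]; exact Submodule.isClosed_topologicalClosure _

lemma testJet_mem_H20 (ψ : TestFunction Ω ℝ (⊤ : ℕ∞)) : testJet ψ ∈ H20 Ω := by
  rw [H20_eq]; exact Submodule.le_topologicalClosure _ (testJet_mem ψ)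

/-- Density of test functions in `H²₀(Ω)`. -/
lemma H20_induction {p : Jet Ω → Prop} (hp : IsClosed {u | p u}) (h : ∀ ψ, p (testJet ψ))
    {u : Jet Ω} (hu : u ∈ H20 Ω) : p u := by
  rw [H20_eq] at hu
  have : closure (testJets Ω : Set (Jet Ω)) ⊆ {u | p u} := by
    refine closure_minimal (fun v hv => ?_) hp
    obtain ⟨ψ, rfl⟩ := mem_testJets_iff.1 hv
    exact h ψ
  exact this hu

/-- Green's formula in `H²₀(Ω)`. -/
lemma sum_inner_grad_eq {u v : Jet Ω} (hu : u ∈ H20 Ω) (hv : v ∈ H20 Ω) :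
    ∑ i, inner ℝ (grad u i) (grad v i) = -inner ℝ (val u) (lap v) := by
  refine H20_induction (p := fun u => ∑ i, inner ℝ (grad u i) (grad v i) =
    -inner ℝ (val u) (lap v)) (isClosed_eq ?_ ?_) (fun ψ => ?_) hu
  · exact continuous_finsetSum _ fun i _ => (continuous_grad i).inner continuous_const
  · exact (continuous_val.inner continuous_const).neg
  · rw [lap, inner_sum, ← Finset.sum_neg_distrib]
    refine Finset.sum_congr rfl fun i _ => ?_
    -- Only `u` is approximated: `v` enters through its weak derivatives, tested against `ψ`.
    have h := hasWeakPartial_iff.1 (hv.1.2 i i) ψ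
    rw [real_inner_comm]
    refine h.trans ?_
    rw [real_inner_comm]
    rfl

lemma pderiv_comm (i j : Fin d) {f : EuclideanSpace ℝ (Fin d) → ℝ}
    (hf : ContDiff ℝ (⊤ : ℕ∞) f) : pderiv i (pderiv j f) = pderiv j (pderiv i f) := by
  have hd : Differentiable ℝ (fderiv ℝ f) :=
    (hf.fderiv_right (m := (⊤ : ℕ∞)) (by simp)).differentiable (by simp)
  have h : ∀ (i j : Fin d) x, pderiv i (pderiv j f) x =
      fderiv ℝ (fderiv ℝ f) x (EuclideanSpace.single i 1) (EuclideanSpace.single j 1) := by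
    intro i j x
    unfold pderiv
    rw [fderiv_clm_apply (hd x) (differentiableAt_const _)]
    simp
  funext x
  rw [h, h]
  exact (hf.contDiffAt.isSymmSndFDerivAt (by simpa using WithTop.coe_le_coe.2 (le_top : (2 : ℕ∞) ≤ ⊤))).eq _ _

/-- For a test function, integrating by parts twice turns `∫ (∂ᵢ∂ⱼψ)²` into `∫ ∂ᵢ²ψ ∂ⱼ²ψ`; there are
no boundary terms. -/
lemma sum_norm_hess_sq {u : Jet Ω} (hu : u ∈ H20 Ω) :
    ∑ i, ∑ j, ‖hess u i j‖ ^ 2 = ‖lap u‖ ^ 2 := by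
  refine H20_induction (p := fun u => ∑ i, ∑ j, ‖hess u i j‖ ^ 2 = ‖lap u‖ ^ 2)
    (isClosed_eq ?_ ?_) (fun ψ => ?_) hu
  · exact continuous_finsetSum _ fun i _ => continuous_finsetSum _ fun j _ =>
      (continuous_hess i j).norm.pow 2
  · exact continuous_lap.norm.pow 2
  · have hcomm : ∀ i j (χ : TestFunction Ω ℝ (⊤ : ℕ∞)),
        testPderiv i (testPderiv j χ) = testPderiv j (testPderiv i χ) := fun i j χ =>
      DFunLike.coe_injective (pderiv_comm i j χ.contDiff)
    rw [← real_inner_self_eq_norm_sq, lap, sum_inner]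
    refine Finset.sum_congr rfl fun i _ => ?_
    rw [inner_sum]
    refine Finset.sum_congr rfl fun j _ => ?_
    rw [← real_inner_self_eq_norm_sq]
    change inner ℝ (testL2 (testPderiv i (testPderiv j ψ))) (testL2 (testPderiv i (testPderiv j ψ)))
      = inner ℝ (testL2 (testPderiv i (testPderiv i ψ))) (testL2 (testPderiv j (testPderiv j ψ)))
    rw [inner_testL2_pderiv i (testPderiv j ψ), inner_testL2_pderiv j (testPderiv j ψ),
      hcomm i j ψ, hcomm i j (testPderiv i ψ)]

lemma norm_hess_le {u : Jet Ω} (hu : u ∈ H20 Ω) (i j : Fin d) : ‖hess u i j‖ ≤ ‖lap u‖ := by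
  refine le_of_sq_le_sq ?_ (norm_nonneg _)
  rw [← sum_norm_hess_sq hu]
  calc ‖hess u i j‖ ^ 2 ≤ ∑ j, ‖hess u i j‖ ^ 2 :=
        Finset.single_le_sum (f := fun j => ‖hess u i j‖ ^ 2) (fun _ _ => sq_nonneg _)
          (Finset.mem_univ j)
    _ ≤ _ := Finset.single_le_sum (f := fun i => ∑ j, ‖hess u i j‖ ^ 2)
          (fun _ _ => Finset.sum_nonneg fun _ _ => sq_nonneg _) (Finset.mem_univ i)

end TestJet

/-! ### Modulation by plane waves, with real functions. -/

section Modulation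

/-- The plane wave `cos (⟨ξ, x⟩ + θ)`. -/
def wave (ξ : EuclideanSpace ℝ (Fin d)) (θ : ℝ) (x : EuclideanSpace ℝ (Fin d)) : ℝ :=
  Real.cos (inner ℝ ξ x + θ)

lemma contDiff_wave (ξ : EuclideanSpace ℝ (Fin d)) (θ : ℝ) :
    ContDiff ℝ (⊤ : ℕ∞) (wave ξ θ) :=
  Real.contDiff_cos.comp ((contDiff_const.inner ℝ contDiff_id).add contDiff_const)

lemma abs_wave_le (ξ : EuclideanSpace ℝ (Fin d)) (θ : ℝ) (x) : |wave ξ θ x| ≤ 1 :=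
  Real.abs_cos_le_one _

/-- Shifting `θ` by `π / 2` plays the role of multiplication by `i`. The phases `0` and `-π / 2`
give the cosine and the sine, the real and imaginary parts of `exp(i⟨ξ,x⟩)`. -/
lemma pderiv_wave (i : Fin d) (ξ : EuclideanSpace ℝ (Fin d)) (θ : ℝ) :
    pderiv i (wave ξ θ) = ξ i • wave ξ (θ + Real.pi / 2) := by
  funext x
  have h1 : HasFDerivAt (fun x : EuclideanSpace ℝ (Fin d) => inner ℝ ξ x + θ) (innerSL ℝ ξ) x :=
    (innerSL ℝ ξ).hasFDerivAt.add_const θ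
  have h2 := h1.cos
  rw [pderiv, show fderiv ℝ (wave ξ θ) x = _ from h2.fderiv]
  simp only [wave, Pi.smul_apply, smul_apply, innerSL_apply_apply,
    EuclideanSpace.inner_single_right, smul_eq_mul, ← add_assoc, Real.cos_add_pi_div_two]
  simp [mul_comm]

lemma wave_add_pi (ξ : EuclideanSpace ℝ (Fin d)) (θ : ℝ) (x) :
    wave ξ (θ + Real.pi / 2 + Real.pi / 2) x = -wave ξ θ x := by
  rw [wave, wave, ← Real.cos_add_pi]
  congr 1; ring

lemma memLp_wave (ξ : EuclideanSpace ℝ (Fin d)) (θ : ℝ) :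
    MemLp (wave ξ θ) ⊤ (volume.restrict (Ω : Set (EuclideanSpace ℝ (Fin d)))) :=
  memLp_top_of_bound (contDiff_wave ξ θ).continuous.aestronglyMeasurable 1
    (Eventually.of_forall fun x => abs_wave_le ξ θ x)

/-- Multiplication by a plane wave. -/
def waveMul (ξ : EuclideanSpace ℝ (Fin d)) (θ : ℝ) : L2 Ω →L[ℝ] L2 Ω :=
  (ContinuousLinearMap.mul ℝ ℝ).holderL (volume.restrict (Ω : Set (EuclideanSpace ℝ (Fin d))))
    ⊤ 2 2 ((memLp_wave ξ θ).toLp _)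

lemma coeFn_waveMul (ξ : EuclideanSpace ℝ (Fin d)) (θ : ℝ) (f : L2 Ω) :
    waveMul ξ θ f =ᵐ[volume.restrict (Ω : Set (EuclideanSpace ℝ (Fin d)))]
      fun x => wave ξ θ x * f x := by
  refine ((ContinuousLinearMap.mul ℝ ℝ).coeFn_holder _ f).trans ?_
  filter_upwards [(memLp_wave (Ω := Ω) ξ θ).coeFn_toLp] with x hx
  rw [hx]; rfl

lemma norm_sq_eq_integral (f : L2 Ω) :
    ‖f‖ ^ 2 = ∫ x in (Ω : Set (EuclideanSpace ℝ (Fin d))), f x ^ 2 := by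
  rw [← real_inner_self_eq_norm_sq, L2.inner_def]
  simp [sq]

lemma integrable_sq (f : L2 Ω) :
    Integrable (fun x => f x ^ 2) (volume.restrict (Ω : Set (EuclideanSpace ℝ (Fin d)))) :=
  (Lp.memLp f).integrable_sq

/-- Pythagoras for the real and imaginary parts of `(f + i g) exp (i ⟨ξ, x⟩)`. -/
lemma norm_sq_waveMul_add (ξ : EuclideanSpace ℝ (Fin d)) (f g : L2 Ω) :
    ‖waveMul ξ 0 f + waveMul ξ (0 + Real.pi / 2) g‖ ^ 2 +
      ‖waveMul ξ (-(Real.pi / 2)) f + waveMul ξ (-(Real.pi / 2) + Real.pi / 2) g‖ ^ 2 =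
      ‖f‖ ^ 2 + ‖g‖ ^ 2 := by
  rw [norm_sq_eq_integral, norm_sq_eq_integral, norm_sq_eq_integral f, norm_sq_eq_integral g,
    ← integral_add (integrable_sq _) (integrable_sq _),
    ← integral_add (integrable_sq _) (integrable_sq _)]
  refine integral_congr_ae ?_
  filter_upwards [Lp.coeFn_add (waveMul ξ 0 f) (waveMul ξ (0 + Real.pi / 2) g),
    Lp.coeFn_add (waveMul ξ (-(Real.pi / 2)) f) (waveMul ξ (-(Real.pi / 2) + Real.pi / 2) g),
    coeFn_waveMul ξ 0 f, coeFn_waveMul ξ (0 + Real.pi / 2) g,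
    coeFn_waveMul ξ (-(Real.pi / 2)) f, coeFn_waveMul ξ (-(Real.pi / 2) + Real.pi / 2) g]
    with x h1 h2 h3 h4 h5 h6
  rw [h1, h2, Pi.add_apply, Pi.add_apply, h3, h4, h5, h6]
  simp only [wave, zero_add, add_zero, neg_add_cancel, Real.cos_add_pi_div_two, ← sub_eq_add_neg,
    Real.cos_sub_pi_div_two]
  linear_combination (f x ^ 2 + g x ^ 2) * Real.cos_sq_add_sin_sq (inner ℝ ξ x)

/-- The jet of the product of a function by a plane wave. -/
def waveJet (ξ : EuclideanSpace ℝ (Fin d)) (θ : ℝ) (u : Jet Ω) : Jet Ω :=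
  (waveMul ξ θ (val u),
    fun i => waveMul ξ θ (grad u i) + ξ i • waveMul ξ (θ + Real.pi / 2) (val u),
    fun i j => waveMul ξ θ (hess u i j) + ξ i • waveMul ξ (θ + Real.pi / 2) (grad u j) +
      ξ j • waveMul ξ (θ + Real.pi / 2) (grad u i) - (ξ i * ξ j) • waveMul ξ θ (val u))

lemma continuous_waveJet (ξ : EuclideanSpace ℝ (Fin d)) (θ : ℝ) :
    Continuous (waveJet ξ θ : Jet Ω → Jet Ω) := by
  have hv := continuous_val (Ω := Ω)
  have hg := continuous_grad (Ω := Ω)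
  have hh := continuous_hess (Ω := Ω)
  refine Continuous.prodMk ((waveMul ξ θ).continuous.comp hv) (Continuous.prodMk ?_ ?_)
  · refine continuous_pi fun i => ?_
    exact ((waveMul ξ θ).continuous.comp (hg i)).add
      (((waveMul ξ _).continuous.comp hv).const_smul (ξ i))
  · refine continuous_pi fun i => continuous_pi fun j => ?_
    exact ((((waveMul ξ θ).continuous.comp (hh i j)).add
      (((waveMul ξ _).continuous.comp (hg j)).const_smul (ξ i))).add
      (((waveMul ξ _).continuous.comp (hg i)).const_smul (ξ j))).sub
      (((waveMul ξ θ).continuous.comp hv).const_smul (ξ i * ξ j))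

/-- The product of a test function by a smooth function. -/
def testMul {c : EuclideanSpace ℝ (Fin d) → ℝ} (hc : ContDiff ℝ (⊤ : ℕ∞) c)
    (ψ : TestFunction Ω ℝ (⊤ : ℕ∞)) : TestFunction Ω ℝ (⊤ : ℕ∞) where
  toFun := c * ψ
  contDiff' := hc.mul ψ.contDiff
  hasCompactSupport' := ψ.hasCompactSupport.mul_left
  tsupport_subset' := (tsupport_mul_subset_right).trans ψ.tsupport_subset

lemma pderiv_mul (i : Fin d) {f g : EuclideanSpace ℝ (Fin d) → ℝ}
    (hf : ContDiff ℝ (⊤ : ℕ∞) f) (hg : ContDiff ℝ (⊤ : ℕ∞) g) :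
    pderiv i (f * g) = f * pderiv i g + pderiv i f * g := by
  funext x
  simp [pderiv, fderiv_mul (hf.differentiable (by simp) x) (hg.differentiable (by simp) x),
    mul_comm]

/-- The Leibniz rule for test functions; by density it makes `waveJet` preserve `H20 Ω`. -/
lemma waveJet_testJet (ξ : EuclideanSpace ℝ (Fin d)) (θ : ℝ) (ψ : TestFunction Ω ℝ (⊤ : ℕ∞)) :
    waveJet ξ θ (testJet ψ) = testJet (testMul (contDiff_wave ξ θ) ψ) := by
  have hw : ∀ θ, ContDiff ℝ (⊤ : ℕ∞) (wave ξ θ) := contDiff_wave ξ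
  have hmul : ∀ θ (χ : TestFunction Ω ℝ (⊤ : ℕ∞)),
      waveMul ξ θ (testL2 χ) = testL2 (testMul (contDiff_wave ξ θ) χ) := fun θ χ => by
    refine Lp.ext ((coeFn_waveMul ξ θ _).trans ?_)
    filter_upwards [coeFn_testL2 χ, coeFn_testL2 (testMul (contDiff_wave ξ θ) χ)] with x h1 h2
    rw [h1, h2]; rfl
  have hwm : ∀ θ {f : EuclideanSpace ℝ (Fin d) → ℝ}, ContDiff ℝ (⊤ : ℕ∞) f →
      ContDiff ℝ (⊤ : ℕ∞) (wave ξ θ * f) := fun θ _ hf => (hw θ).mul hf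
  have hws : ∀ (c θ : ℝ) {f : EuclideanSpace ℝ (Fin d) → ℝ}, ContDiff ℝ (⊤ : ℕ∞) f →
      ContDiff ℝ (⊤ : ℕ∞) (c • (wave ξ θ * f)) := fun c θ _ hf => contDiff_const.smul (hwm θ hf)
  have hadd : ∀ χ χ' : TestFunction Ω ℝ (⊤ : ℕ∞), testL2 χ + testL2 χ' = testL2 (χ + χ') :=
    fun _ _ => rfl
  have hsub : ∀ χ χ' : TestFunction Ω ℝ (⊤ : ℕ∞), testL2 χ - testL2 χ' = testL2 (χ - χ') :=
    fun _ _ => rfl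
  have hsmul : ∀ (c : ℝ) (χ : TestFunction Ω ℝ (⊤ : ℕ∞)), c • testL2 χ = testL2 (c • χ) :=
    fun _ _ => rfl
  refine Prod.ext (hmul θ ψ) (Prod.ext (funext fun i => ?_) (funext fun i => funext fun j => ?_))
  · change waveMul ξ θ (testL2 _) + ξ i • waveMul ξ (θ + Real.pi / 2) (testL2 _) = testL2 _
    rw [hmul, hmul, hsmul, hadd]
    congr 1
    refine DFunLike.coe_injective ?_
    change wave ξ θ * pderiv i ψ + ξ i • (wave ξ (θ + Real.pi / 2) * ψ) =
      pderiv i (wave ξ θ * ψ)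
    rw [pderiv_mul i (hw θ) ψ.contDiff, pderiv_wave, smul_mul_assoc]
  · change waveMul ξ θ (testL2 _) + ξ i • waveMul ξ (θ + Real.pi / 2) (testL2 _) +
      ξ j • waveMul ξ (θ + Real.pi / 2) (testL2 _) - (ξ i * ξ j) • waveMul ξ θ (testL2 _) = testL2 _
    rw [hmul, hmul, hmul, hmul, hsmul, hsmul, hsmul, hadd, hadd, hsub]
    congr 1
    refine DFunLike.coe_injective ?_
    change wave ξ θ * pderiv i (pderiv j ψ) + ξ i • (wave ξ (θ + Real.pi / 2) * pderiv j ψ) +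
      ξ j • (wave ξ (θ + Real.pi / 2) * pderiv i ψ) - (ξ i * ξ j) • (wave ξ θ * ψ) =
      pderiv i (pderiv j (wave ξ θ * ψ))
    rw [pderiv_mul j (hw θ) ψ.contDiff, pderiv_wave, smul_mul_assoc,
      pderiv_add i (hwm θ (contDiff_pderiv j ψ.contDiff)) (hws _ _ ψ.contDiff),
      pderiv_smul i (ξ j) (hwm _ ψ.contDiff),
      pderiv_mul i (hw θ) (contDiff_pderiv j ψ.contDiff), pderiv_mul i (hw _) ψ.contDiff,
      pderiv_wave, pderiv_wave]
    funext x
    simp only [Pi.add_apply, Pi.sub_apply, Pi.smul_apply, Pi.mul_apply, smul_eq_mul, wave_add_pi]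
    ring

lemma waveJet_mem {u : Jet Ω} (hu : u ∈ H20 Ω) (ξ : EuclideanSpace ℝ (Fin d)) (θ : ℝ) :
    waveJet ξ θ u ∈ H20 Ω :=
  H20_induction (p := fun u => waveJet ξ θ u ∈ H20 Ω)
    (isClosed_H20.preimage (continuous_waveJet ξ θ))
    (fun ψ => by rw [waveJet_testJet]; exact testJet_mem_H20 _) hu

/-- The real form of `Δ(e u) = e (Δu - |ξ|² u + 2i ξ·∇u)` with `e = exp(i⟨ξ,x⟩)`. -/
lemma lap_waveJet (ξ : EuclideanSpace ℝ (Fin d)) (θ : ℝ) (u : Jet Ω) :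
    lap (waveJet ξ θ u) = waveMul ξ θ (lap u - ‖ξ‖ ^ 2 • val u) +
      waveMul ξ (θ + Real.pi / 2) ((2 : ℝ) • ∑ i, ξ i • grad u i) := by
  have h : ∀ i, hess (waveJet ξ θ u) i i = waveMul ξ θ (hess u i i - (ξ i ^ 2) • val u) +
      waveMul ξ (θ + Real.pi / 2) ((2 : ℝ) • ξ i • grad u i) := fun i => by
    change waveMul ξ θ (hess u i i) + ξ i • waveMul ξ (θ + Real.pi / 2) (grad u i) +
      ξ i • waveMul ξ (θ + Real.pi / 2) (grad u i) - (ξ i * ξ i) • waveMul ξ θ (val u) = _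
    simp only [map_sub, map_smul]
    module
  rw [lap, Finset.sum_congr rfl fun i _ => h i, Finset.sum_add_distrib, ← map_sum, ← map_sum,
    Finset.sum_sub_distrib, ← Finset.sum_smul, ← Finset.smul_sum, EuclideanSpace.norm_sq_eq]
  simp [lap]

lemma sum_norm_grad_waveJet (ξ : EuclideanSpace ℝ (Fin d)) (u : Jet Ω) :
    (∑ i, ‖grad (waveJet ξ 0 u) i‖ ^ 2) + ∑ i, ‖grad (waveJet ξ (-(Real.pi / 2)) u) i‖ ^ 2 =
      (∑ i, ‖grad u i‖ ^ 2) + ‖ξ‖ ^ 2 * ‖val u‖ ^ 2 := by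
  rw [EuclideanSpace.norm_sq_eq, Finset.sum_mul, ← Finset.sum_add_distrib,
    ← Finset.sum_add_distrib]
  refine Finset.sum_congr rfl fun i _ => ?_
  have h := norm_sq_waveMul_add ξ (grad u i) (ξ i • val u)
  rw [map_smul, map_smul, norm_smul, mul_pow] at h
  exact h

lemma norm_lap_waveJet (ξ : EuclideanSpace ℝ (Fin d)) (u : Jet Ω) :
    ‖lap (waveJet ξ 0 u)‖ ^ 2 + ‖lap (waveJet ξ (-(Real.pi / 2)) u)‖ ^ 2 =
      ‖lap u - ‖ξ‖ ^ 2 • val u‖ ^ 2 + 4 * ‖∑ i, ξ i • grad u i‖ ^ 2 := by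
  rw [lap_waveJet, lap_waveJet, norm_sq_waveMul_add, norm_smul, mul_pow]
  norm_num

/-- The value of the quadratic form `z ‖∇f‖² - ‖Δf‖²` on a modulated function. -/
lemma quadratic_waveJet {u : Jet Ω} (hu : u ∈ H20 Ω) (ξ : EuclideanSpace ℝ (Fin d)) (z : ℝ) :
    (z * (∑ i, ‖grad (waveJet ξ 0 u) i‖ ^ 2) - ‖lap (waveJet ξ 0 u)‖ ^ 2) +
      (z * (∑ i, ‖grad (waveJet ξ (-(Real.pi / 2)) u) i‖ ^ 2) -
        ‖lap (waveJet ξ (-(Real.pi / 2)) u)‖ ^ 2) =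
      z * (∑ i, ‖grad u i‖ ^ 2) + z * ‖val u‖ ^ 2 * ‖ξ‖ ^ 2 - ‖lap u‖ ^ 2
        - 2 * (∑ i, ‖grad u i‖ ^ 2) * ‖ξ‖ ^ 2 - ‖val u‖ ^ 2 * ‖ξ‖ ^ 4
        - 4 * ∑ i, ∑ j, inner ℝ (grad u i) (grad u j) * (ξ i * ξ j) := by
  have h1 := sum_norm_grad_waveJet ξ u
  have h2 := norm_lap_waveJet ξ u
  have h3 : ‖∑ i, ξ i • grad u i‖ ^ 2 =
      ∑ i, ∑ j, inner ℝ (grad u i) (grad u j) * (ξ i * ξ j) := by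
    rw [← real_inner_self_eq_norm_sq, sum_inner]
    refine Finset.sum_congr rfl fun i _ => ?_
    rw [inner_sum]
    refine Finset.sum_congr rfl fun j _ => ?_
    rw [real_inner_smul_left, real_inner_smul_right]
    ring
  -- The cross term is `-2 |ξ|² ⟨Δu, u⟩ = 2 |ξ|² ‖∇u‖²` by Green's formula.
  have h4 : ‖lap u - ‖ξ‖ ^ 2 • val u‖ ^ 2 =
      ‖lap u‖ ^ 2 + 2 * ‖ξ‖ ^ 2 * (∑ i, ‖grad u i‖ ^ 2) + ‖ξ‖ ^ 4 * ‖val u‖ ^ 2 := by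
    have h5 := sum_inner_grad_eq hu hu
    simp only [real_inner_self_eq_norm_sq] at h5
    rw [norm_sub_sq_real, real_inner_smul_right, norm_smul, h5, real_inner_comm]
    simp only [norm_pow, norm_norm]
    ring
  rw [h3, h4] at h2
  linear_combination z * h1 - h2

end Modulation

/-! ### Plancherel on `L¹ ∩ L²`. -/

section Plancherel

open FourierTransform

variable {V : Type*} [NormedAddCommGroup V] [InnerProductSpace ℝ V] [FiniteDimensional ℝ V]
  [MeasurableSpace V] [BorelSpace V]

/-- The Fourier integral of a function in `L¹ ∩ L²` represents its `L²`-Fourier transform. -/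
lemma fourier_toLp_ae_eq {g : V → ℂ} (h1 : Integrable g) (h2 : MemLp g 2) :
    ((𝓕 (h2.toLp g) : Lp ℂ 2 (volume : Measure V)) : V → ℂ) =ᵐ[volume] 𝓕 g := by
  have hcont : Continuous (𝓕 g) := VectorFourier.fourierIntegral_continuous
    Real.continuous_fourierChar (by exact continuous_inner) h1
  refine ae_eq_of_integral_contDiff_smul_eq ((Lp.memLp _).locallyIntegrable (by norm_num))
    hcont.locallyIntegrable fun h hh hc => ?_
  have hc' : HasCompactSupport (fun x => (h x : ℂ)) := hc.comp_left (g := Complex.ofReal) rfl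
  let H : SchwartzMap V ℂ := hc'.toSchwartzMap (Complex.ofRealCLM.contDiff.comp hh)
  have e1 : ∀ F : V → ℂ, ∫ x, h x • F x = ∫ x, H x • F x := fun F =>
    integral_congr_ae (Eventually.of_forall fun x => by
      change (h x) • F x = (h x : ℂ) • F x
      simp)
  -- Both transforms are tested against smooth compactly supported `h`: on the `L²` side as tempered
  -- distributions, on the `L¹` side by moving the transform across the integral.
  have key := congrArg (fun D => D H) (Lp.fourier_toTemperedDistribution_eq (h2.toLp g))
  simp only [TemperedDistribution.fourier_apply, Lp.toTemperedDistribution_apply] at key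
  rw [e1, e1, ← key]
  have e2 : ∫ x, (𝓕 H) x • (h2.toLp g) x = ∫ x, (𝓕 H) x • g x := by
    refine integral_congr_ae ?_
    filter_upwards [h2.coeFn_toLp] with x hx
    rw [hx]
  rw [e2]
  simpa using! VectorFourier.integral_bilin_fourierIntegral_eq_flip
    (ContinuousLinearMap.lsmul ℂ ℂ : ℂ →L[ℂ] ℂ →L[ℂ] ℂ) (L := innerₗ V)
    Real.continuous_fourierChar continuous_inner H.integrable h1

/-- Plancherel's theorem for the Fourier integral of a function in `L¹ ∩ L²`. -/
lemma integral_norm_fourier_sq {g : V → ℂ} (h1 : Integrable g) (h2 : MemLp g 2) :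
    Integrable (fun ξ => ‖𝓕 g ξ‖ ^ 2) ∧ ∫ ξ, ‖𝓕 g ξ‖ ^ 2 = ∫ x, ‖g x‖ ^ 2 := by
  have hae := fourier_toLp_ae_eq h1 h2
  have hm : MemLp (𝓕 g) 2 := (memLp_congr_ae hae).1 (Lp.memLp _)
  refine ⟨hm.integrable_norm_pow (by norm_num), ?_⟩
  have hn : ∀ f : Lp ℂ 2 (volume : Measure V), ‖f‖ ^ 2 = ∫ x, ‖f x‖ ^ 2 := fun f => by
    have h := L2.inner_def (𝕜 := ℂ) f f
    rw [inner_self_eq_norm_sq_to_K] at h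
    simp only [inner_self_eq_norm_sq_to_K] at h
    have h' : ((‖f‖ ^ 2 : ℝ) : ℂ) = ((∫ x, ‖f x‖ ^ 2 : ℝ) : ℂ) := by
      rw [← integral_complex_ofReal]
      simpa using h
    exact_mod_cast h'
  calc ∫ ξ, ‖𝓕 g ξ‖ ^ 2 = ∫ ξ, ‖(𝓕 (h2.toLp g) : Lp ℂ 2 (volume : Measure V)) ξ‖ ^ 2 := by
        refine integral_congr_ae ?_
        filter_upwards [hae] with x hx
        rw [hx]
    _ = ‖h2.toLp g‖ ^ 2 := by rw [← hn, Lp.norm_fourier_eq]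
    _ = ∫ x, ‖g x‖ ^ 2 := by
        rw [hn]
        refine integral_congr_ae ?_
        filter_upwards [h2.coeFn_toLp] with x hx
        rw [hx]

end Plancherel

/-! ### Fourier coefficients of functions on `Ω`. -/

section WaveCoefficients

variable [IsFiniteMeasure (volume.restrict (Ω : Set (EuclideanSpace ℝ (Fin d))))]

variable (Ω) in
/-- A plane wave as an element of `L²(Ω)`, for `Ω` of finite measure. -/
def waveL2 (ξ : EuclideanSpace ℝ (Fin d)) (θ : ℝ) : L2 Ω :=
  ((memLp_wave ξ θ).mono_exponent le_top : MemLp (wave ξ θ) 2 _).toLp (wave ξ θ)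

lemma coeFn_waveL2 (ξ : EuclideanSpace ℝ (Fin d)) (θ : ℝ) :
    waveL2 Ω ξ θ =ᵐ[volume.restrict (Ω : Set (EuclideanSpace ℝ (Fin d)))] wave ξ θ :=
  MemLp.coeFn_toLp _

lemma inner_waveL2 (f : L2 Ω) (ξ : EuclideanSpace ℝ (Fin d)) (θ : ℝ) :
    inner ℝ f (waveL2 Ω ξ θ) =
      ∫ x in (Ω : Set (EuclideanSpace ℝ (Fin d))), f x * wave ξ θ x := by
  rw [L2.inner_def]
  refine integral_congr_ae ?_
  filter_upwards [coeFn_waveL2 (Ω := Ω) ξ θ] with x hx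
  rw [hx]
  simp [mul_comm]

/-- The squared modulus of `∫_Ω f(x) exp(-i⟨ξ,x⟩) dx`. -/
def spectralDensity (f : L2 Ω) (ξ : EuclideanSpace ℝ (Fin d)) : ℝ :=
  inner ℝ f (waveL2 Ω ξ 0) ^ 2 + inner ℝ f (waveL2 Ω ξ (-(Real.pi / 2))) ^ 2

lemma spectralDensity_nonneg (f : L2 Ω) (ξ : EuclideanSpace ℝ (Fin d)) :
    0 ≤ spectralDensity f ξ := by unfold spectralDensity; positivity

lemma integrable_L2 (f : L2 Ω) :
    Integrable f (volume.restrict (Ω : Set (EuclideanSpace ℝ (Fin d)))) :=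
  (Lp.memLp f).integrable (by norm_num)

-- `𝓕` uses `exp(-2πi⟨x,ξ⟩)` whereas the waves use `⟨ξ,x⟩`; this rescaling is the source of the
-- factor `(2π)^d`.
open FourierTransform in
lemma spectralDensity_eq (f : L2 Ω) (ξ : EuclideanSpace ℝ (Fin d)) :
    spectralDensity f ((2 * Real.pi) • ξ) =
      ‖𝓕 ((Ω : Set (EuclideanSpace ℝ (Fin d))).indicator fun x => (f x : ℂ)) ξ‖ ^ 2 := by
  have hint : ∀ θ, Integrable (fun x => f x * wave ((2 * Real.pi) • ξ) θ x)
      (volume.restrict (Ω : Set (EuclideanSpace ℝ (Fin d)))) := fun θ =>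
    (integrable_L2 f).mul_bdd (c := 1) (contDiff_wave _ θ).continuous.aestronglyMeasurable
      (Eventually.of_forall fun x => abs_wave_le _ θ x)
  have h : 𝓕 ((Ω : Set (EuclideanSpace ℝ (Fin d))).indicator fun x => (f x : ℂ)) ξ =
      ((inner ℝ f (waveL2 Ω ((2 * Real.pi) • ξ) 0) : ℝ) : ℂ) -
        ((inner ℝ f (waveL2 Ω ((2 * Real.pi) • ξ) (-(Real.pi / 2))) : ℝ) : ℂ) * Complex.I := by
    rw [inner_waveL2, inner_waveL2, ← integral_complex_ofReal, ← integral_complex_ofReal,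
      ← integral_mul_const, ← integral_sub (hint _).ofReal ((hint _).ofReal.mul_const _),
      Real.fourier_eq', ← integral_indicator Ω.isOpen.measurableSet]
    refine integral_congr_ae (Eventually.of_forall fun x => ?_)
    by_cases hx : x ∈ (Ω : Set (EuclideanSpace ℝ (Fin d)))
    · simp only [Set.indicator_of_mem hx]
      have h1 : (((-2 * Real.pi * inner ℝ x ξ : ℝ) : ℂ) * Complex.I) =
        ((-(inner ℝ ((2 * Real.pi) • ξ) x) : ℝ) : ℂ) * Complex.I := by
        rw [real_inner_smul_left, real_inner_comm]
        congr 2; ring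
      rw [h1, Complex.exp_mul_I]
      simp only [wave, add_zero, ← sub_eq_add_neg, Real.cos_sub_pi_div_two]
      rw [← Complex.ofReal_cos, ← Complex.ofReal_sin, Real.cos_neg, Real.sin_neg]
      push_cast
      simp only [smul_eq_mul]
      ring
    · simp [Set.indicator_of_notMem hx]
  rw [h, ← Complex.normSq_eq_norm_sq, Complex.normSq_apply, spectralDensity]
  simp [sq]

lemma integrable_spectralDensity_aux (f : L2 Ω) :
    Integrable (fun ξ => spectralDensity f ((2 * Real.pi) • ξ)) ∧
    ∫ ξ, spectralDensity f ((2 * Real.pi) • ξ) = ‖f‖ ^ 2 := by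
  have h1 : Integrable ((Ω : Set (EuclideanSpace ℝ (Fin d))).indicator fun x => (f x : ℂ)) :=
    (integrable_indicator_iff Ω.isOpen.measurableSet).2 (integrable_L2 f).ofReal
  have h2 : MemLp ((Ω : Set (EuclideanSpace ℝ (Fin d))).indicator fun x => (f x : ℂ)) 2 :=
    (memLp_indicator_iff_restrict Ω.isOpen.measurableSet).2 (Lp.memLp f).ofReal
  have h := integral_norm_fourier_sq h1 h2
  simp only [← spectralDensity_eq] at h
  refine ⟨h.1, h.2.trans ?_⟩
  rw [norm_sq_eq_integral, ← integral_indicator Ω.isOpen.measurableSet]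
  refine integral_congr_ae (Eventually.of_forall fun x => ?_)
  by_cases hx : x ∈ (Ω : Set (EuclideanSpace ℝ (Fin d)))
  · simp [Set.indicator_of_mem hx]
  · simp [Set.indicator_of_notMem hx]

lemma integrable_spectralDensity (f : L2 Ω) : Integrable (spectralDensity f) :=
  (integrable_comp_smul_iff volume (spectralDensity f)
    (by positivity : (2 * Real.pi) ≠ 0)).1 (integrable_spectralDensity_aux f).1

/-- Plancherel's theorem for functions in `L²(Ω)`. -/
lemma integral_spectralDensity (f : L2 Ω) :
    ∫ ξ, spectralDensity f ξ = (2 * Real.pi) ^ d * ‖f‖ ^ 2 := by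
  have h := Measure.integral_comp_smul (volume : Measure (EuclideanSpace ℝ (Fin d)))
    (spectralDensity f) (2 * Real.pi)
  rw [(integrable_spectralDensity_aux f).2, finrank_euclideanSpace_fin, smul_eq_mul,
    abs_of_nonneg (by positivity)] at h
  rw [h, ← mul_assoc, mul_inv_cancel₀ (by positivity), one_mul]

lemma norm_waveL2_sq_add (ξ : EuclideanSpace ℝ (Fin d)) :
    ‖waveL2 Ω ξ 0‖ ^ 2 + ‖waveL2 Ω ξ (-(Real.pi / 2))‖ ^ 2 =
      volume.real (Ω : Set (EuclideanSpace ℝ (Fin d))) := by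
  rw [norm_sq_eq_integral, norm_sq_eq_integral, ← integral_add (integrable_sq _) (integrable_sq _)]
  have : ∫ _ in (Ω : Set (EuclideanSpace ℝ (Fin d))), (1 : ℝ) =
      volume.real (Ω : Set (EuclideanSpace ℝ (Fin d))) := by simp
  rw [← this]
  refine integral_congr_ae ?_
  filter_upwards [coeFn_waveL2 (Ω := Ω) ξ 0, coeFn_waveL2 (Ω := Ω) ξ (-(Real.pi / 2))] with x h1 h2
  rw [h1, h2]
  simp only [wave, add_zero, ← sub_eq_add_neg, Real.cos_sub_pi_div_two, Real.cos_sq_add_sin_sq]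

lemma spectralDensity_le (f : L2 Ω) (ξ : EuclideanSpace ℝ (Fin d)) :
    spectralDensity f ξ ≤ ‖f‖ ^ 2 * volume.real (Ω : Set (EuclideanSpace ℝ (Fin d))) := by
  have h : ∀ θ, inner ℝ f (waveL2 Ω ξ θ) ^ 2 ≤ ‖f‖ ^ 2 * ‖waveL2 Ω ξ θ‖ ^ 2 := fun θ => by
    rw [← mul_pow, ← sq_abs]
    exact pow_le_pow_left₀ (abs_nonneg _) (abs_real_inner_le_norm _ _) 2
  rw [← norm_waveL2_sq_add (Ω := Ω) ξ, mul_add]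
  exact add_le_add (h _) (h _)

/-- Makes the waves of bounded frequency a compact subset of `L²(Ω)`, hence covered by finitely many
small balls. -/
lemma continuous_waveL2 (θ : ℝ) : Continuous fun ξ => waveL2 Ω ξ θ := by
  rw [continuous_iff_continuousAt]
  intro η
  rw [ContinuousAt, tendsto_iff_norm_sub_tendsto_zero]
  have h1 : ∀ ξ, ‖waveL2 Ω ξ θ - waveL2 Ω η θ‖ ^ 2 =
      ∫ x in (Ω : Set (EuclideanSpace ℝ (Fin d))), (wave ξ θ x - wave η θ x) ^ 2 := fun ξ => by
    rw [norm_sq_eq_integral]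
    refine integral_congr_ae ?_
    filter_upwards [Lp.coeFn_sub (waveL2 Ω ξ θ) (waveL2 Ω η θ), coeFn_waveL2 (Ω := Ω) ξ θ,
      coeFn_waveL2 (Ω := Ω) η θ] with x h1 h2 h3
    rw [h1, Pi.sub_apply, h2, h3]
  have h2 : Continuous fun ξ =>
      ∫ x in (Ω : Set (EuclideanSpace ℝ (Fin d))), (wave ξ θ x - wave η θ x) ^ 2 := by
    refine continuous_of_dominated (bound := fun _ => 4) (fun ξ => ?_) (fun ξ => ?_)
      (integrable_const _) ?_
    · exact (((contDiff_wave ξ θ).continuous.sub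
        (contDiff_wave η θ).continuous).pow 2).aestronglyMeasurable
    · refine Eventually.of_forall fun x => ?_
      have h3 := abs_le.1 (abs_wave_le ξ θ x)
      have h4 := abs_le.1 (abs_wave_le η θ x)
      rw [Real.norm_of_nonneg (sq_nonneg _)]
      nlinarith
    · refine Eventually.of_forall fun x => ?_
      unfold wave
      fun_prop
  have h3 := h2.tendsto η
  simp only [sub_self, ne_eq, OfNat.ofNat_ne_zero, not_false_eq_true, zero_pow,
    integral_zero] at h3
  have h4 := h3.sqrt
  rw [Real.sqrt_zero] at h4
  refine h4.congr fun ξ => ?_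
  rw [← h1, Real.sqrt_sq (norm_nonneg _)]

/-- A wave does not vanish on the boundary of `Ω`, but `u` is a limit of test functions, so
integration by parts leaves no boundary term. -/
lemma inner_grad_waveL2 {u : Jet Ω} (hu : u ∈ H20 Ω) (i : Fin d) (ξ : EuclideanSpace ℝ (Fin d))
    (θ : ℝ) : inner ℝ (grad u i) (waveL2 Ω ξ θ) =
      -(ξ i * inner ℝ (val u) (waveL2 Ω ξ (θ + Real.pi / 2))) := by
  refine H20_induction (p := fun u => inner ℝ (grad u i) (waveL2 Ω ξ θ) =
      -(ξ i * inner ℝ (val u) (waveL2 Ω ξ (θ + Real.pi / 2))))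
    (isClosed_eq ((continuous_grad i).inner continuous_const)
      ((continuous_val.inner continuous_const).const_mul _).neg) (fun ψ => ?_) hu
  have h : ∀ (χ : TestFunction Ω ℝ (⊤ : ℕ∞)) θ, inner ℝ (testL2 χ) (waveL2 Ω ξ θ) =
      ∫ x, χ x * wave ξ θ x := fun χ θ => by
    rw [inner_waveL2, ← setIntegral_eq_integral_of_forall_compl_eq_zero
      (s := (Ω : Set (EuclideanSpace ℝ (Fin d)))) (f := fun x => χ x * wave ξ θ x)
      fun x hx => by
        rw [image_eq_zero_of_notMem_tsupport fun hh => hx (χ.tsupport_subset hh), zero_mul]]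
    refine integral_congr_ae ?_
    filter_upwards [coeFn_testL2 χ] with x hx
    rw [hx]
  have hint : ∀ (χ : TestFunction Ω ℝ (⊤ : ℕ∞)) θ, Integrable fun x => χ x * wave ξ θ x :=
    fun χ θ => (χ.continuous.mul (contDiff_wave ξ θ).continuous).integrable_of_hasCompactSupport
      χ.hasCompactSupport.mul_right
  have hpw : ∀ x, fderiv ℝ (wave ξ θ) x (EuclideanSpace.single i 1) =
      ξ i * wave ξ (θ + Real.pi / 2) x := fun x => congrFun (pderiv_wave i ξ θ) x
  have hparts := integral_mul_fderiv_eq_neg_fderiv_mul_of_integrable (μ := volume)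
    (f := ψ) (g := wave ξ θ) (v := EuclideanSpace.single i 1)
    (hint (testPderiv i ψ) θ)
    (by
      simp only [hpw, mul_left_comm _ (ξ i)]
      exact (hint ψ _).const_mul _)
    (hint ψ θ)
    (fun x _ => ψ.contDiff.differentiable (by simp) x)
    (fun x _ => (contDiff_wave ξ θ).differentiable (by simp) x)
  simp only [hpw, mul_left_comm _ (ξ i), integral_const_mul] at hparts
  change inner ℝ (testL2 (testPderiv i ψ)) _ = -(ξ i * inner ℝ (testL2 ψ) _)
  rw [h, h, hparts, neg_neg]
  rfl

lemma spectralDensity_grad {u : Jet Ω} (hu : u ∈ H20 Ω) (i : Fin d)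
    (ξ : EuclideanSpace ℝ (Fin d)) :
    spectralDensity (grad u i) ξ = ξ i ^ 2 * spectralDensity (val u) ξ := by
  have h : waveL2 Ω ξ (0 + Real.pi / 2) = -waveL2 Ω ξ (-(Real.pi / 2)) := by
    refine Lp.ext ?_
    filter_upwards [coeFn_waveL2 (Ω := Ω) ξ (0 + Real.pi / 2),
      coeFn_waveL2 (Ω := Ω) ξ (-(Real.pi / 2)), Lp.coeFn_neg (waveL2 Ω ξ (-(Real.pi / 2)))]
      with x h1 h2 h3
    rw [h3, Pi.neg_apply, h1, h2, wave, wave, ← add_assoc, add_zero, ← sub_eq_add_neg,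
      Real.cos_add_pi_div_two, Real.cos_sub_pi_div_two]
  rw [spectralDensity, spectralDensity, inner_grad_waveL2 hu, inner_grad_waveL2 hu,
    neg_add_cancel, h, inner_neg_right]
  ring

/-- The low frequency part and the gradient control a function of `H²₀(Ω)`. -/
lemma norm_val_sq_le {u : Jet Ω} (hu : u ∈ H20 Ω) {R : ℝ} (hR : 0 < R) {D : ℝ}
    (hD : ∀ ξ ∈ Metric.closedBall (0 : EuclideanSpace ℝ (Fin d)) R, spectralDensity (val u) ξ ≤ D) :
    (2 * Real.pi) ^ d * ‖val u‖ ^ 2 ≤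
      volume.real (Metric.closedBall (0 : EuclideanSpace ℝ (Fin d)) R) * D +
        (R ^ 2)⁻¹ * ((2 * Real.pi) ^ d * ∑ i, ‖grad u i‖ ^ 2) := by
  have h1 : Integrable fun ξ => ∑ i, spectralDensity (grad u i) ξ :=
    integrable_finsetSum _ fun i _ => integrable_spectralDensity _
  have h2 : ∫ ξ, ∑ i, spectralDensity (grad u i) ξ = (2 * Real.pi) ^ d * ∑ i, ‖grad u i‖ ^ 2 := by
    rw [integral_finsetSum _ fun i _ => integrable_spectralDensity _, Finset.mul_sum]
    exact Finset.sum_congr rfl fun i _ => integral_spectralDensity _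
  have h3 : ∀ ξ, ∑ i, spectralDensity (grad u i) ξ = ‖ξ‖ ^ 2 * spectralDensity (val u) ξ :=
    fun ξ => by
      rw [EuclideanSpace.norm_sq_eq, Finset.sum_mul]
      refine Finset.sum_congr rfl fun i _ => ?_
      rw [spectralDensity_grad hu, Real.norm_eq_abs, sq_abs]
  have hm : MeasurableSet (Metric.closedBall (0 : EuclideanSpace ℝ (Fin d)) R) :=
    measurableSet_closedBall
  have hfin : volume (Metric.closedBall (0 : EuclideanSpace ℝ (Fin d)) R) ≠ ⊤ :=
    measure_closedBall_lt_top.ne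
  have h4 : Integrable ((Metric.closedBall (0 : EuclideanSpace ℝ (Fin d)) R).indicator fun _ => D) :=
    (integrable_indicator_iff hm).2 (integrableOn_const hfin)
  rw [← integral_spectralDensity, ← h2, ← integral_const_mul, ← smul_eq_mul (a := volume.real _),
    ← integral_indicator_const D hm, ← integral_add h4 (h1.const_mul _)]
  -- Pointwise bound of the density: by `D` inside the ball, and outside it by using `1 ≤ ‖ξ‖² /
  -- R²`.
  refine integral_mono (integrable_spectralDensity _) (h4.add (h1.const_mul _)) fun ξ => ?_
  have hnn := spectralDensity_nonneg (val u) ξ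
  simp only [h3]
  by_cases hξ : ξ ∈ Metric.closedBall (0 : EuclideanSpace ℝ (Fin d)) R
  · rw [Set.indicator_of_mem hξ]
    have : 0 ≤ (R ^ 2)⁻¹ * (‖ξ‖ ^ 2 * spectralDensity (val u) ξ) := by positivity
    linarith [hD ξ hξ]
  · rw [Set.indicator_of_notMem hξ, zero_add, ← mul_assoc]
    refine le_mul_of_one_le_left hnn ?_
    rw [mem_closedBall_zero_iff, not_le] at hξ
    rw [inv_mul_eq_div, one_le_div (by positivity)]
    exact pow_le_pow_left₀ hR.le hξ.le 2

end WaveCoefficients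

/-! ### Poincaré inequality, control by the Laplacian, and a Rellich-type estimate. -/

section Bounds

variable [IsFiniteMeasure (volume.restrict (Ω : Set (EuclideanSpace ℝ (Fin d))))]

variable (Ω) in
/-- The Poincaré inequality on a domain of finite measure. -/
lemma exists_poincare (hd : 0 < d) : ∃ C > 0, ∀ u ∈ H20 Ω,
    ‖val u‖ ^ 2 ≤ C * ∑ i, ‖grad u i‖ ^ 2 := by
  set B := volume.real (Metric.ball (0 : EuclideanSpace ℝ (Fin d)) 1)
  set W := volume.real (Ω : Set (EuclideanSpace ℝ (Fin d)))
  set P := (2 * Real.pi) ^ d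
  have hB : 0 ≤ B := measureReal_nonneg
  have hW : 0 ≤ W := measureReal_nonneg
  have hP : 0 < P := by positivity
  -- So small that the low frequencies carry at most half of `P * ‖val u‖ ^ 2` and are absorbed on
  -- the left; `R ≤ 1` gives `R ^ d ≤ R`.
  set R := min 1 (P / (2 * (B * W + 1)))
  have hR : 0 < R := lt_min one_pos (by positivity)
  have hR1 : R ≤ 1 := min_le_left _ _
  have hR2 : R * (B * W) ≤ P / 2 := by
    calc R * (B * W) ≤ P / (2 * (B * W + 1)) * (B * W + 1) :=
          mul_le_mul (min_le_right _ _) (by linarith) (by positivity) (by positivity)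
      _ = P / 2 := by field_simp
  have hRd : R ^ d ≤ R := by
    calc R ^ d ≤ R ^ 1 := pow_le_pow_of_le_one hR.le hR1 hd
      _ = R := pow_one R
  refine ⟨2 * (R ^ 2)⁻¹, by positivity, fun u hu => ?_⟩
  have h := norm_val_sq_le hu hR (D := ‖val u‖ ^ 2 * W) fun ξ _ => spectralDensity_le _ _
  rw [Measure.addHaar_real_closedBall _ _ hR.le, finrank_euclideanSpace_fin] at h
  have h1 : R ^ d * B * (‖val u‖ ^ 2 * W) ≤ P / 2 * ‖val u‖ ^ 2 := by
    calc R ^ d * B * (‖val u‖ ^ 2 * W) = R ^ d * (B * W) * ‖val u‖ ^ 2 := by ring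
      _ ≤ R * (B * W) * ‖val u‖ ^ 2 := by gcongr
      _ ≤ _ := by gcongr
  have h2 : P / 2 * ‖val u‖ ^ 2 ≤ P / 2 * (2 * (R ^ 2)⁻¹ * ∑ i, ‖grad u i‖ ^ 2) := by
    calc P / 2 * ‖val u‖ ^ 2 ≤ (R ^ 2)⁻¹ * (P * ∑ i, ‖grad u i‖ ^ 2) := by linarith
      _ = _ := by ring
  exact le_of_mul_le_mul_left h2 (by positivity)

omit [IsFiniteMeasure (volume.restrict (Ω : Set (EuclideanSpace ℝ (Fin d))))] in
lemma sum_norm_grad_sq_le {u : Jet Ω} (hu : u ∈ H20 Ω) :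
    ∑ i, ‖grad u i‖ ^ 2 ≤ ‖val u‖ * ‖lap u‖ := by
  have h := sum_inner_grad_eq hu hu
  simp only [real_inner_self_eq_norm_sq] at h
  rw [h]
  exact (neg_le_abs _).trans (abs_real_inner_le_norm _ _)

variable (Ω) in
/-- The Laplacian controls the function and its gradient on `H²₀(Ω)`. -/
lemma exists_lap_bound (hd : 0 < d) : ∃ C > 0, ∀ u ∈ H20 Ω,
    ‖val u‖ ≤ C * ‖lap u‖ ∧ ∑ i, ‖grad u i‖ ^ 2 ≤ C * ‖lap u‖ ^ 2 := by
  obtain ⟨C, hC, h⟩ := exists_poincare Ω hd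
  refine ⟨C, hC, fun u hu => ?_⟩
  have h1 := h u hu
  have h2 := sum_norm_grad_sq_le hu
  have h3 : ‖val u‖ ≤ C * ‖lap u‖ := by
    rcases (norm_nonneg (val u)).eq_or_lt with h0 | h0
    · rw [← h0]; positivity
    · refine le_of_mul_le_mul_left ?_ h0
      nlinarith
  exact ⟨h3, h2.trans (by nlinarith [norm_nonneg (lap u)])⟩

-- The Laplacian is thus bounded below on `H20 Ω`, which gives its injectivity and closed range.
variable (Ω) in
lemma exists_norm_le (hd : 0 < d) : ∃ C > 0, ∀ u ∈ H20 Ω, ‖u‖ ≤ C * ‖lap u‖ := by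
  obtain ⟨C, hC, h⟩ := exists_lap_bound Ω hd
  refine ⟨C + 1, by positivity, fun u hu => ?_⟩
  obtain ⟨h1, h2⟩ := h u hu
  have hl := norm_nonneg (lap u)
  refine norm_prod_le_iff.2 ⟨?_, norm_prod_le_iff.2 ⟨?_, ?_⟩⟩
  · exact h1.trans (by nlinarith)
  · refine (pi_norm_le_iff_of_nonneg (by positivity)).2 fun i => ?_
    refine le_of_sq_le_sq ?_ (by positivity)
    calc ‖grad u i‖ ^ 2 ≤ ∑ i, ‖grad u i‖ ^ 2 :=
          Finset.single_le_sum (f := fun i => ‖grad u i‖ ^ 2) (fun _ _ => sq_nonneg _)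
            (Finset.mem_univ i)
      _ ≤ C * ‖lap u‖ ^ 2 := h2
      _ ≤ ((C + 1) * ‖lap u‖) ^ 2 := by
          rw [mul_pow]
          gcongr
          nlinarith
  · refine (pi_norm_le_iff_of_nonneg (by positivity)).2 fun i =>
      (pi_norm_le_iff_of_nonneg (by positivity)).2 fun j => ?_
    exact (norm_hess_le hu i j).trans (by nlinarith)

variable (Ω) in
/-- Functions of `H²₀(Ω)` orthogonal to finitely many plane waves are small in `L²(Ω)`. -/
lemma exists_finite_small (hd : 0 < d) {ε : ℝ} (hε : 0 < ε) : ∃ s : Set (L2 Ω), s.Finite ∧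
    ∀ u ∈ H20 Ω, (∀ e ∈ s, inner ℝ (val u) e = 0) → ‖val u‖ ≤ ε * ‖lap u‖ := by
  obtain ⟨C, hC, h⟩ := exists_lap_bound Ω hd
  set P := (2 * Real.pi) ^ d
  have hP : 0 < P := by positivity
  -- `R` makes the high-frequency term at most half of `P * ε ^ 2 * ‖lap u‖ ^ 2`; `δ` below does the
  -- same for the low frequencies.
  set R := Real.sqrt (2 * C) / ε
  have hR : 0 < R := by positivity
  have hR2 : (R ^ 2)⁻¹ * C = ε ^ 2 / 2 := by
    rw [div_pow, Real.sq_sqrt (by positivity)]; field_simp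
  set A := volume.real (Metric.closedBall (0 : EuclideanSpace ℝ (Fin d)) R)
  have hA : 0 ≤ A := measureReal_nonneg
  set δ := Real.sqrt (P * ε ^ 2 / (4 * C ^ 2 * (A + 1)))
  have hδ : 0 < δ := Real.sqrt_pos.2 (by positivity)
  have hδ2 : A * (2 * δ ^ 2 * C ^ 2) ≤ P * (ε ^ 2 / 2) := by
    rw [Real.sq_sqrt (by positivity)]
    calc A * (2 * (P * ε ^ 2 / (4 * C ^ 2 * (A + 1))) * C ^ 2)
        ≤ (A + 1) * (2 * (P * ε ^ 2 / (4 * C ^ 2 * (A + 1))) * C ^ 2) := by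
          gcongr; linarith
      _ = P * (ε ^ 2 / 2) := by field_simp; norm_num
  -- A finite `δ`-net of the waves with `|ξ| ≤ R`; orthogonality to the net bounds every
  -- low-frequency coefficient by `δ * ‖val u‖`.
  have hnet : ∀ θ, ∃ t : Set (L2 Ω), t.Finite ∧
      ∀ ξ ∈ Metric.closedBall (0 : EuclideanSpace ℝ (Fin d)) R, ∃ e ∈ t,
        ‖waveL2 Ω ξ θ - e‖ ≤ δ := fun θ => by
    obtain ⟨t, -, ht, hcov⟩ := ((isCompact_closedBall (0 : EuclideanSpace ℝ (Fin d)) R).image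
      (continuous_waveL2 (Ω := Ω) θ)).finite_cover_balls hδ
    refine ⟨t, ht, fun ξ hξ => ?_⟩
    obtain ⟨e, he, hd⟩ := Set.mem_iUnion₂.1 (hcov (Set.mem_image_of_mem _ hξ))
    exact ⟨e, he, (mem_ball_iff_norm.1 hd).le⟩
  choose t ht hnet using hnet
  refine ⟨t 0 ∪ t (-(Real.pi / 2)), (ht _).union (ht _), fun u hu horth => ?_⟩
  obtain ⟨h1, h2⟩ := h u hu
  have hco : ∀ θ ∈ ({0, -(Real.pi / 2)} : Set ℝ),
      ∀ ξ ∈ Metric.closedBall (0 : EuclideanSpace ℝ (Fin d)) R,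
      inner ℝ (val u) (waveL2 Ω ξ θ) ^ 2 ≤ δ ^ 2 * ‖val u‖ ^ 2 := by
    intro θ hθ ξ hξ
    obtain ⟨e, he, hd⟩ := hnet θ ξ hξ
    have h0 : inner ℝ (val u) e = 0 := by
      refine horth e ?_
      rcases hθ with rfl | rfl
      · exact Or.inl he
      · exact Or.inr he
    have h3 : |inner ℝ (val u) (waveL2 Ω ξ θ)| ≤ δ * ‖val u‖ := by
      calc |inner ℝ (val u) (waveL2 Ω ξ θ)| = |inner ℝ (val u) (waveL2 Ω ξ θ - e)| := by
            rw [inner_sub_right, h0, sub_zero]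
        _ ≤ ‖val u‖ * ‖waveL2 Ω ξ θ - e‖ := abs_real_inner_le_norm _ _
        _ ≤ ‖val u‖ * δ := by gcongr
        _ = _ := mul_comm _ _
    rw [← sq_abs, ← mul_pow]
    exact pow_le_pow_left₀ (abs_nonneg _) h3 2
  have h4 := norm_val_sq_le hu hR (D := 2 * δ ^ 2 * ‖val u‖ ^ 2) fun ξ hξ => by
    have := hco 0 (by simp) ξ hξ
    have := hco (-(Real.pi / 2)) (by simp) ξ hξ
    unfold spectralDensity
    linarith
  have h5 : ‖val u‖ ^ 2 ≤ C ^ 2 * ‖lap u‖ ^ 2 := by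
    rw [← mul_pow]; exact pow_le_pow_left₀ (norm_nonneg _) h1 2
  have h6 : P * ‖val u‖ ^ 2 ≤ P * (ε ^ 2 * ‖lap u‖ ^ 2) := by
    calc P * ‖val u‖ ^ 2
        ≤ A * (2 * δ ^ 2 * ‖val u‖ ^ 2) + (R ^ 2)⁻¹ * (P * ∑ i, ‖grad u i‖ ^ 2) := h4
      _ ≤ A * (2 * δ ^ 2 * (C ^ 2 * ‖lap u‖ ^ 2)) + (R ^ 2)⁻¹ * (P * (C * ‖lap u‖ ^ 2)) := by
          gcongr
      _ = A * (2 * δ ^ 2 * C ^ 2) * ‖lap u‖ ^ 2 + P * ((R ^ 2)⁻¹ * C) * ‖lap u‖ ^ 2 := by ring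
      _ ≤ P * (ε ^ 2 / 2) * ‖lap u‖ ^ 2 + P * (ε ^ 2 / 2) * ‖lap u‖ ^ 2 := by
          rw [hR2]; gcongr
      _ = _ := by ring
  refine le_of_sq_le_sq ?_ (by positivity)
  rw [mul_pow]
  exact le_of_mul_le_mul_left h6 hP

end Bounds

/-! ### Infinite dimension of `H²₀(Ω)`. -/

section Dimension

lemma testL2_ne_zero {ψ : TestFunction Ω ℝ (⊤ : ℕ∞)} {x : EuclideanSpace ℝ (Fin d)} (hx : x ∈ Ω)
    (h : ψ x ≠ 0) : testL2 ψ ≠ 0 := by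
  intro h0
  have h1 : ψ =ᵐ[volume.restrict (Ω : Set (EuclideanSpace ℝ (Fin d)))]
      (0 : EuclideanSpace ℝ (Fin d) → ℝ) := by
    refine (coeFn_testL2 ψ).symm.trans ?_
    rw [h0]
    exact Lp.coeFn_zero _ _ _
  exact h (Measure.eqOn_open_of_ae_eq h1 Ω.isOpen ψ.continuous.continuousOn
    continuous_zero.continuousOn hx)

/-- Bump functions supported in infinitely many disjoint open subsets are orthogonal in `L²(Ω)`.
Without this the eigenvalues might not form an infinite sequence. -/
lemma not_finiteDimensional_H20 (hd : 0 < d) (hΩ : (Ω : Set (EuclideanSpace ℝ (Fin d))).Nonempty) :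
    ¬ FiniteDimensional ℝ (H20 Ω) := by
  intro hfin
  have : NeZero d := ⟨hd.ne'⟩
  have : Infinite (Ω : Set (EuclideanSpace ℝ (Fin d))) :=
    (infinite_of_mem_nhds _ (Ω.isOpen.mem_nhds hΩ.some_mem)).to_subtype
  obtain ⟨U, hinf, hop, hdis⟩ := exists_seq_infinite_isOpen_pairwise_disjoint
    (Ω : Set (EuclideanSpace ℝ (Fin d)))
  have hψ : ∀ n, ∃ ψ : TestFunction Ω ℝ (⊤ : ℕ∞), ∃ x ∈ Ω, ψ x ≠ 0 ∧
      tsupport ψ ⊆ Subtype.val '' U n := fun n => by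
    obtain ⟨x, hx⟩ := (hinf n).nonempty
    have hopen : IsOpen (Subtype.val '' U n) := Ω.isOpen.isOpenMap_subtype_val _ (hop n)
    obtain ⟨f, hf1, hf2, hf3, -, hf5⟩ := exists_contDiff_tsupport_subset (n := ⊤)
      (hopen.mem_nhds (Set.mem_image_of_mem _ hx))
    exact ⟨⟨f, hf3, hf2, hf1.trans (Subtype.coe_image_subset _ _)⟩, x, x.2,
      by change f x ≠ 0; rw [hf5]; exact one_ne_zero, hf1⟩
  choose ψ x hx hne hsupp using hψ
  have hortho : Pairwise fun m n => inner ℝ (testL2 (ψ m)) (testL2 (ψ n)) = 0 := by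
    intro m n hmn
    rw [← integral_mul_test]
    refine integral_eq_zero_of_ae ?_
    filter_upwards [coeFn_testL2 (ψ m)] with y hy
    rw [hy]
    by_cases h1 : y ∈ tsupport (ψ m)
    · have h2 : y ∉ tsupport (ψ n) := fun h2 =>
        Set.disjoint_left.1 ((Set.disjoint_image_iff Subtype.val_injective).2 (hdis hmn))
          (hsupp m h1) (hsupp n h2)
      rw [image_eq_zero_of_notMem_tsupport h2, mul_zero]; rfl
    · rw [image_eq_zero_of_notMem_tsupport h1, zero_mul]; rfl
  have hli := linearIndependent_of_ne_zero_of_inner_eq_zero (𝕜 := ℝ)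
    (fun n => testL2_ne_zero (hx n) (hne n)) hortho
  let valH : H20 Ω →ₗ[ℝ] L2 Ω := LinearMap.fst ℝ _ _ ∘ₗ (H20 Ω).subtype
  have hli' : LinearIndependent ℝ fun n => (⟨testJet (ψ n), testJet_mem_H20 _⟩ : H20 Ω) :=
    LinearIndependent.of_comp valH hli
  exact not_finite_iff_infinite.2 inferInstance hli'.finite

end Dimension

/-! ### The buckling operator. -/

section Operator

lemma eq_zero_of_inner_test {f : L2 Ω} (h : ∀ ψ : TestFunction Ω ℝ (⊤ : ℕ∞),
    inner ℝ f (testL2 ψ) = 0) : f = 0 := by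
  refine Lp.ext ?_
  refine EventuallyEq.trans ?_ (Lp.coeFn_zero _ _ _).symm
  have hloc : LocallyIntegrableOn f (Ω : Set (EuclideanSpace ℝ (Fin d))) volume :=
    (locallyIntegrableOn_of_locallyIntegrable_restrict
      ((Lp.memLp f).locallyIntegrable (by norm_num)))
  refine (ae_restrict_iff' Ω.isOpen.measurableSet).2
    (IsOpen.ae_eq_zero_of_integral_contDiff_smul_eq_zero Ω.isOpen hloc fun g hg hc hs => ?_)
  let ψ : TestFunction Ω ℝ (⊤ : ℕ∞) := ⟨g, hg, hc, hs⟩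
  have := h ψ
  rw [← integral_mul_test] at this
  rw [← setIntegral_eq_integral_of_forall_compl_eq_zero
    (s := (Ω : Set (EuclideanSpace ℝ (Fin d)))) fun x hx => by
      rw [image_eq_zero_of_notMem_tsupport fun hh => hx (hs hh), zero_smul]]
  rw [← this]
  exact integral_congr_ae (Eventually.of_forall fun x => mul_comm _ _)

lemma HasWeakPartial.eq_zero {i : Fin d} {g : L2 Ω} (h : HasWeakPartial i 0 g) : g = 0 :=
  eq_zero_of_inner_test fun ψ => by
    have := hasWeakPartial_iff.1 h ψ
    rw [inner_zero_left] at this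
    linarith

/-- Yields the strict positivity of the buckling operator. -/
lemma lap_eq_zero_of_grad {u : Jet Ω} (hu : u ∈ H20 Ω) (h : ∀ i, grad u i = 0) : lap u = 0 :=
  Finset.sum_eq_zero fun i _ => HasWeakPartial.eq_zero (h i ▸ hu.1.2 i i)

variable (Ω) in
/-- The buckling problem as the spectral problem of a compact positive operator. -/
lemma exists_bucklingOperator [IsFiniteMeasure (volume.restrict (Ω : Set (EuclideanSpace ℝ (Fin d))))]
    (hd : 0 < d) :
    ∃ (K : Submodule ℝ (L2 Ω)) (_ : CompleteSpace K) (S : K ≃ₗ[ℝ] H20 Ω) (T : K →L[ℝ] K),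
      IsCompactOperator T ∧ T.IsSymmetric ∧ (∀ k, lap (S k : Jet Ω) = k) ∧
      (∀ k l, inner ℝ (T k) l = ∑ i, inner ℝ (grad (S k : Jet Ω) i) (grad (S l : Jet Ω) i)) ∧
      ∀ k, k ≠ 0 → 0 < inner ℝ (T k) k := by
  let lapL : H20 Ω →L[ℝ] L2 Ω :=
    { toFun := fun u => lap (u : Jet Ω)
      map_add' := fun u v => lap_add _ _
      map_smul' := fun c u => lap_smul _ _
      cont := continuous_lap.comp continuous_subtype_val }
  have : CompleteSpace (H20 Ω) := isClosed_H20.completeSpace_coe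
  obtain ⟨C, hC, hbound⟩ := exists_norm_le Ω hd
  have hanti : AntilipschitzWith ⟨C, hC.le⟩ lapL :=
    ContinuousLinearMap.antilipschitz_of_bound lapL fun u => hbound u u.2
  have hclosed : IsClosed (Set.range lapL) := hanti.isClosed_range lapL.uniformContinuous
  let Φ := ContinuousLinearMap.equivRange hanti.injective hclosed
  let K : Submodule ℝ (L2 Ω) := (lapL : H20 Ω →ₗ[ℝ] L2 Ω).range
  have hK : CompleteSpace K := by
    have : IsClosed (K : Set (L2 Ω)) := by
      rw [LinearMap.coe_range]; exact hclosed
    exact this.completeSpace_coe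
  let S : K ≃L[ℝ] H20 Ω := Φ.symm
  have hlap : ∀ k, lap (S k : Jet Ω) = k := fun k => congrArg Subtype.val (Φ.apply_symm_apply k)
  let G : K →L[ℝ] PiLp 2 (fun _ : Fin d => L2 Ω) :=
    { toFun := fun k => WithLp.toLp 2 fun i => grad (S k : Jet Ω) i
      map_add' := fun k l => by
        rw [map_add]; rfl
      map_smul' := fun c k => by
        rw [map_smul]; rfl
      cont := (PiLp.continuous_toLp 2 _).comp (continuous_pi fun i =>
        (continuous_grad i).comp (continuous_subtype_val.comp S.continuous)) }
  have hG : ∀ k l, inner ℝ (G k) (G l) =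
      ∑ i, inner ℝ (grad (S k : Jet Ω) i) (grad (S l : Jet Ω) i) := fun k l =>
    PiLp.inner_apply _ _
  -- With `G` sending `Δu` to `∇u`, this represents the gradient form in the inner product of `K`,
  -- symmetrically and positively.
  let T : K →L[ℝ] K := G.adjoint ∘L G
  have hT : ∀ k l, inner ℝ (T k) l = inner ℝ (G k) (G l) := fun k l =>
    ContinuousLinearMap.adjoint_inner_left G l (G k)
  have hGn : ∀ k, ‖G k‖ ^ 2 = ∑ i, ‖grad (S k : Jet Ω) i‖ ^ 2 := fun k => by
    rw [← real_inner_self_eq_norm_sq, hG]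
    exact Finset.sum_congr rfl fun i _ => real_inner_self_eq_norm_sq _
  let A : K →L[ℝ] L2 Ω :=
    { toFun := fun k => val (S k : Jet Ω)
      map_add' := fun k l => by rw [map_add]; rfl
      map_smul' := fun c k => by rw [map_smul]; rfl
      cont := continuous_val.comp (continuous_subtype_val.comp S.continuous) }
  have hcomp : IsCompactOperator G := by
    refine isCompactOperator_of_small G fun ε hε => ?_
    -- Tolerance `ε ^ 2`, because `‖G k‖ ^ 2 ≤ ‖val u‖ * ‖k‖` for `u = S k`. The adjoint of `A`
    -- turns orthogonality of `val u` to `s` into a finite-codimension condition on `k`.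
    obtain ⟨s, hs, hsmall⟩ := exists_finite_small Ω hd (pow_pos hε 2)
    refine ⟨Submodule.span ℝ (A.adjoint '' s), FiniteDimensional.span_of_finite ℝ (hs.image _),
      fun k hk => ?_⟩
    have h1 := hsmall (S k) (S k).2 fun e he => by
      have h := (Submodule.mem_orthogonal _ _).1 hk _
        (Submodule.subset_span (Set.mem_image_of_mem _ he))
      rw [ContinuousLinearMap.adjoint_inner_left, real_inner_comm] at h
      exact h
    have h2 := sum_norm_grad_sq_le (S k).2
    rw [← hGn] at h2
    rw [hlap] at h1 h2
    refine le_of_sq_le_sq ?_ (by positivity)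
    calc ‖G k‖ ^ 2 ≤ ‖val (S k : Jet Ω)‖ * ‖k‖ := h2
      _ ≤ ε ^ 2 * ‖k‖ * ‖k‖ := mul_le_mul_of_nonneg_right h1 (norm_nonneg _)
      _ = _ := by ring
  refine ⟨K, hK, S.toLinearEquiv, T, hcomp.clm_comp G.adjoint, fun k l => ?_, hlap,
    fun k l => (hT k l).trans (hG k l), fun k hk => ?_⟩
  · change inner ℝ (T k) l = inner ℝ k (T l)
    rw [hT, real_inner_comm, ← hT, real_inner_comm]
  · rw [hT, real_inner_self_eq_norm_sq]
    refine pow_pos (norm_pos_iff.2 fun h0 => hk ?_) 2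
    refine Subtype.ext ?_
    rw [← hlap k]
    refine lap_eq_zero_of_grad (S k).2 fun i => ?_
    exact congrFun (congrArg WithLp.ofLp h0) i

end Operator

/-! ### Buckling eigenspaces versus eigenspaces of the operator. -/

section Correspondence

variable {K : Submodule ℝ (L2 Ω)} {S : K ≃ₗ[ℝ] H20 Ω} {T : K →L[ℝ] K}

/-- The buckling eigenspaces are the images of the eigenspaces of the buckling operator. -/
def eigenspaceEquiv (hS : ∀ k, lap (S k : Jet Ω) = k)
    (hT : ∀ k l, inner ℝ (T k) l = ∑ i, inner ℝ (grad (S k : Jet Ω) i) (grad (S l : Jet Ω) i))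
    (t : ℝ) : recipEigenspace T t ≃ₗ[ℝ] eigenspace Ω t :=
  have hmem : ∀ k, k ∈ recipEigenspace T t ↔ (S k : Jet Ω) ∈ eigenspace Ω t := fun k => by
    rw [mem_recipEigenspace]
    constructor
    · intro h
      refine ⟨(S k).2, fun w hw => ?_⟩
      obtain ⟨l, hl⟩ := S.surjective ⟨w, hw⟩
      have hw' : w = (S l : Jet Ω) := by rw [hl]
      rw [hw', hS, hS, ← hT]
      change inner ℝ k l = _
      nth_rewrite 1 [← h]
      rw [real_inner_smul_left]
    · rintro ⟨-, h⟩
      refine ext_inner_right ℝ fun l => ?_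
      have := h _ (S l).2
      rw [hS, hS, ← hT] at this
      rw [real_inner_smul_left, ← this]
      rfl
  LinearEquiv.ofBijective
    (((H20 Ω).subtype ∘ₗ (S : K →ₗ[ℝ] H20 Ω) ∘ₗ (recipEigenspace T t).subtype).codRestrict
      (eigenspace Ω t) fun k => (hmem k).1 k.2)
    ⟨fun k l hkl => by
      have h := congrArg Subtype.val hkl
      exact Subtype.ext (S.injective (Subtype.ext h)),
    fun v => by
      obtain ⟨k, hk⟩ := S.surjective ⟨v, v.2.1⟩
      have hk' : (S k : Jet Ω) = v := by rw [hk]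
      exact ⟨⟨k, (hmem k).2 (hk' ▸ v.2)⟩, Subtype.ext hk'⟩⟩

lemma isEigenvalueSequence_iff (hc : IsCompactOperator T) [CompleteSpace K]
    (hS : ∀ k, lap (S k : Jet Ω) = k)
    (hT : ∀ k l, inner ℝ (T k) l = ∑ i, inner ℝ (grad (S k : Jet Ω) i) (grad (S l : Jet Ω) i))
    {σ : ℕ → ℝ} : IsEigenvalueSequence Ω σ ↔ IsRecipSpectrum T σ := by
  have he := fun t => (eigenspaceEquiv hS hT t).finrank_eq
  constructor
  · rintro ⟨h1, h2, h3, -, h5⟩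
    exact ⟨h1, h2, h3, fun t => (he t).trans (h5 t)⟩
  · rintro ⟨h1, h2, h3, h5⟩
    refine ⟨h1, h2, h3, fun t => ?_, fun t => (he t).symm.trans (h5 t)⟩
    have := finiteDimensional_recipEigenspace hc t
    exact Module.Finite.equiv (eigenspaceEquiv hS hT t)

end Correspondence

/-! ### Moments of a ball. -/

section Moments

lemma setIntegral_norm_pow (hd : 0 < d) {R : ℝ} (hR : 0 ≤ R) (n : ℕ) :
    ∫ ξ in Metric.closedBall (0 : EuclideanSpace ℝ (Fin d)) R, ‖ξ‖ ^ n =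
      d / (d + n) * volume.real (Metric.ball (0 : EuclideanSpace ℝ (Fin d)) 1) * R ^ (d + n) := by
  have : NeZero d := ⟨hd.ne'⟩
  have h := integral_fun_norm_addHaar (volume : Measure (EuclideanSpace ℝ (Fin d)))
    ((Set.Iic R).indicator fun y => y ^ n)
  have h1 : ∀ ξ : EuclideanSpace ℝ (Fin d), (Set.Iic R).indicator (fun y => y ^ n) ‖ξ‖ =
      (Metric.closedBall (0 : EuclideanSpace ℝ (Fin d)) R).indicator (fun ξ => ‖ξ‖ ^ n) ξ := by
    intro ξ
    by_cases hξ : ‖ξ‖ ≤ R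
    · rw [Set.indicator_of_mem (by simpa using hξ), Set.indicator_of_mem (by simpa using hξ)]
    · rw [Set.indicator_of_notMem (by simpa using hξ), Set.indicator_of_notMem (by simpa using hξ)]
  simp only [h1] at h
  rw [integral_indicator measurableSet_closedBall] at h
  rw [h, finrank_euclideanSpace_fin]
  have h2 : ∫ y in Set.Ioi (0 : ℝ), y ^ (d - 1) • (Set.Iic R).indicator (fun y => y ^ n) y =
      R ^ (d + n) / (d + n) := by
    have h3 : ∀ y : ℝ, y ^ (d - 1) • (Set.Iic R).indicator (fun y => y ^ n) y =
        (Set.Iic R).indicator (fun y => y ^ (d - 1 + n)) y := fun y => by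
      rw [smul_eq_mul, ← Set.indicator_mul_right (Set.Iic R) (fun y : ℝ => y ^ (d - 1))]
      simp only [pow_add]
    simp only [h3]
    rw [setIntegral_indicator measurableSet_Iic, Set.Ioi_inter_Iic,
      ← intervalIntegral.integral_of_le hR, integral_pow]
    have h4 : d - 1 + n + 1 = d + n := by omega
    have h5 : ((d - 1 + n : ℕ) : ℝ) + 1 = d + n := by exact_mod_cast h4
    rw [h4, h5, zero_pow (by omega), sub_zero]
  rw [h2]
  simp only [nsmul_eq_mul, smul_eq_mul]
  ring

lemma setIntegral_comp_isometry {R : ℝ} (A : EuclideanSpace ℝ (Fin d) ≃ₗᵢ[ℝ] EuclideanSpace ℝ (Fin d))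
    (f : EuclideanSpace ℝ (Fin d) → ℝ) :
    ∫ ξ in Metric.closedBall (0 : EuclideanSpace ℝ (Fin d)) R, f (A ξ) =
      ∫ ξ in Metric.closedBall (0 : EuclideanSpace ℝ (Fin d)) R, f ξ := by
  have h := A.measurePreserving.setIntegral_preimage_emb A.toHomeomorph.measurableEmbedding f
    (Metric.closedBall 0 R)
  rw [← h]
  congr 2
  ext ξ
  simp

lemma integrableOn_ball {R : ℝ} {f : EuclideanSpace ℝ (Fin d) → ℝ} (hf : Continuous f) :
    IntegrableOn f (Metric.closedBall (0 : EuclideanSpace ℝ (Fin d)) R) :=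
  hf.continuousOn.integrableOn_compact (isCompact_closedBall _ _)

/-- The reflection in the `i`-th coordinate preserves the ball and changes the sign of the
integrand. -/
lemma setIntegral_mul_coord {R : ℝ} {i j : Fin d} (hij : i ≠ j) :
    ∫ ξ in Metric.closedBall (0 : EuclideanSpace ℝ (Fin d)) R, ξ i * ξ j = 0 := by
  classical
  let A : EuclideanSpace ℝ (Fin d) ≃ₗᵢ[ℝ] EuclideanSpace ℝ (Fin d) :=
    LinearIsometryEquiv.piLpCongrRight 2
      fun k => if k = i then LinearIsometryEquiv.neg ℝ else LinearIsometryEquiv.refl ℝ ℝ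
  have h := setIntegral_comp_isometry (R := R) A fun ξ => ξ i * ξ j
  have h1 : ∀ ξ, A ξ i * A ξ j = -(ξ i * ξ j) := fun ξ => by
    simp [A, hij.symm]
  simp only [h1, integral_neg] at h
  linarith

/-- Swapping coordinates shows that all `d` of these moments agree, and they add up to the integral
of `‖ξ‖ ^ 2`. -/
lemma setIntegral_sq_coord (hd : 0 < d) {R : ℝ} (i : Fin d) :
    ∫ ξ in Metric.closedBall (0 : EuclideanSpace ℝ (Fin d)) R, ξ i * ξ i =
      (∫ ξ in Metric.closedBall (0 : EuclideanSpace ℝ (Fin d)) R, ‖ξ‖ ^ 2) / d := by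
  have h1 : ∀ j, ∫ ξ in Metric.closedBall (0 : EuclideanSpace ℝ (Fin d)) R, ξ j * ξ j =
      ∫ ξ in Metric.closedBall (0 : EuclideanSpace ℝ (Fin d)) R, ξ i * ξ i := fun j => by
    rw [← setIntegral_comp_isometry
      (LinearIsometryEquiv.piLpCongrLeft 2 ℝ ℝ (Equiv.swap i j)) fun ξ => ξ i * ξ i]
    simp [LinearIsometryEquiv.piLpCongrLeft_apply, Equiv.piCongrLeft'_apply]
  have h2 : ∀ ξ : EuclideanSpace ℝ (Fin d), ‖ξ‖ ^ 2 = ∑ j, ξ j * ξ j := fun ξ => by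
    rw [EuclideanSpace.norm_sq_eq]
    exact Finset.sum_congr rfl fun j _ => by rw [Real.norm_eq_abs, sq_abs, sq]
  simp only [h2]
  rw [integral_finsetSum _ fun j _ => integrableOn_ball (by fun_prop),
    Finset.sum_congr rfl fun j _ => h1 j]
  have : (d : ℝ) ≠ 0 := by exact_mod_cast hd.ne'
  simp [this]

/-- The integral over a ball of the symbol of the modulated quadratic form. -/
lemma setIntegral_symbol (hd : 0 < d) (u : Jet Ω) {z : ℝ} (hz : 0 < z) :
    ∫ ξ in Metric.closedBall (0 : EuclideanSpace ℝ (Fin d)) (Real.sqrt z),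
      (z * (∑ i, ‖grad u i‖ ^ 2) + z * ‖val u‖ ^ 2 * ‖ξ‖ ^ 2 - ‖lap u‖ ^ 2
        - 2 * (∑ i, ‖grad u i‖ ^ 2) * ‖ξ‖ ^ 2 - ‖val u‖ ^ 2 * ‖ξ‖ ^ 4
        - 4 * ∑ i, ∑ j, inner ℝ (grad u i) (grad u j) * (ξ i * ξ j)) =
      volume.real (Metric.ball (0 : EuclideanSpace ℝ (Fin d)) 1) * Real.sqrt z ^ d *
        (2 * d / ((d + 2) * (d + 4)) * ‖val u‖ ^ 2 * z ^ 2 - (∑ i, ‖grad u i‖ ^ 2) * z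
          - ‖lap u‖ ^ 2) := by
  set R := Real.sqrt z
  have hR : 0 ≤ R := Real.sqrt_nonneg z
  have hR2 : R ^ 2 = z := Real.sq_sqrt hz.le
  have hI : ∀ {f : EuclideanSpace ℝ (Fin d) → ℝ}, Continuous f →
      IntegrableOn f (Metric.closedBall (0 : EuclideanSpace ℝ (Fin d)) R) := fun hf =>
    integrableOn_ball hf
  have hd0 : (d : ℝ) ≠ 0 := by exact_mod_cast hd.ne'
  have V2 := setIntegral_norm_pow hd hR 2
  have V4 := setIntegral_norm_pow hd hR 4
  have hcross : ∫ ξ in Metric.closedBall (0 : EuclideanSpace ℝ (Fin d)) R,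
      ∑ i, ∑ j, inner ℝ (grad u i) (grad u j) * (ξ i * ξ j) =
      (∑ i, ‖grad u i‖ ^ 2) *
        ((∫ ξ in Metric.closedBall (0 : EuclideanSpace ℝ (Fin d)) R, ‖ξ‖ ^ 2) / d) := by
    rw [integral_finsetSum _ fun i _ => hI (by fun_prop), Finset.sum_mul]
    refine Finset.sum_congr rfl fun i _ => ?_
    rw [integral_finsetSum _ fun j _ => hI (by fun_prop), Finset.sum_eq_single i]
    · rw [integral_const_mul, setIntegral_sq_coord hd, real_inner_self_eq_norm_sq]
    · intro j _ hj
      rw [integral_const_mul, setIntegral_mul_coord hj.symm, mul_zero]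
    · simp
  rw [integral_sub (hI (by fun_prop)) (hI (by fun_prop)),
    integral_sub (hI (by fun_prop)) (hI (by fun_prop)),
    integral_sub (hI (by fun_prop)) (hI (by fun_prop)),
    integral_sub (hI (by fun_prop)) (hI (by fun_prop)),
    integral_add (hI (by fun_prop)) (hI (by fun_prop))]
  simp only [integral_const_mul, setIntegral_const, smul_eq_mul, hcross]
  rw [V2, V4, Measure.addHaar_real_closedBall _ _ hR, finrank_euclideanSpace_fin]
  have e2 : R ^ (d + 2) = R ^ d * z := by rw [pow_add, hR2]
  have e4 : R ^ (d + 4) = R ^ d * z ^ 2 := by rw [pow_add, ← hR2]; ring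
  rw [e2, e4]
  push_cast
  have h2 : (d : ℝ) + 2 ≠ 0 := by positivity
  have h4 : (d : ℝ) + 4 ≠ 0 := by positivity
  -- The coefficients are `d/(d+2) - d/(d+4) = 2d/((d+2)(d+4))` for `‖val u‖²` and `1 - 2d/(d+2) -
  -- 4/(d+2) = -1` for the squared gradient.
  field_simp
  ring

end Moments

/-! ### Products with a bounded function. -/

section Product

/-- The product of an essentially bounded function and a function in `L²(Ω)`. -/
def boundedMul (f : L2 Ω) (hf : MemLp f ⊤ (volume.restrict (Ω : Set (EuclideanSpace ℝ (Fin d)))))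
    (g : L2 Ω) : L2 Ω :=
  ((Lp.memLp g).mul hf : MemLp (fun x => f x * g x) 2 _).toLp _

lemma norm_boundedMul_le (f : L2 Ω)
    (hf : MemLp f ⊤ (volume.restrict (Ω : Set (EuclideanSpace ℝ (Fin d))))) (g : L2 Ω) :
    ‖boundedMul f hf g‖ ≤
      (eLpNorm f ⊤ (volume.restrict (Ω : Set (EuclideanSpace ℝ (Fin d))))).toReal * ‖g‖ := by
  rw [boundedMul, Lp.norm_toLp, Lp.norm_def, ← ENNReal.toReal_mul]
  refine ENNReal.toReal_mono (ENNReal.mul_ne_top hf.eLpNorm_ne_top (Lp.eLpNorm_ne_top g)) ?_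
  exact eLpNorm_smul_le_eLpNorm_top_mul_eLpNorm 2 (Lp.aestronglyMeasurable g) f

/-- Moves the wave to the other side, so that testing a modulated `f` against `g` becomes a Fourier
coefficient of the product `f g`. -/
lemma inner_waveMul [IsFiniteMeasure (volume.restrict (Ω : Set (EuclideanSpace ℝ (Fin d))))]
    (f : L2 Ω) (hf : MemLp f ⊤ (volume.restrict (Ω : Set (EuclideanSpace ℝ (Fin d)))))
    (g : L2 Ω) (ξ : EuclideanSpace ℝ (Fin d)) (θ : ℝ) :
    inner ℝ (waveMul ξ θ f) g = inner ℝ (boundedMul f hf g) (waveL2 Ω ξ θ) := by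
  rw [inner_waveL2, L2.inner_def]
  refine integral_congr_ae ?_
  filter_upwards [coeFn_waveMul (Ω := Ω) ξ θ f,
    MemLp.coeFn_toLp ((Lp.memLp g).mul hf : MemLp (fun x => f x * g x) 2 _)] with x h1 h2
  rw [boundedMul, h1, h2]
  simp only [RCLike.inner_apply, conj_trivial, Pi.mul_apply]
  ring

end Product

/-! ### The Riesz mean inequality. -/

section Main

variable [IsFiniteMeasure (volume.restrict (Ω : Set (EuclideanSpace ℝ (Fin d))))]

/-- The lower bound for the Riesz means, integrated over low frequencies. -/
lemma rieszMean_lower_bound (hd : 0 < d) {K : Submodule ℝ (L2 Ω)} [CompleteSpace K]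
    {S : K ≃ₗ[ℝ] H20 Ω} {T : K →L[ℝ] K} (hc : IsCompactOperator T) (hs : T.IsSymmetric)
    (hS : ∀ k, lap (S k : Jet Ω) = k)
    (hT : ∀ k l, inner ℝ (T k) l = ∑ i, inner ℝ (grad (S k : Jet Ω) i) (grad (S l : Jet Ω) i))
    (hpos : ∀ k, k ≠ 0 → 0 < inner ℝ (T k) k) {σ : ℕ → ℝ} (hσ : IsRecipSpectrum T σ)
    {φ : Jet Ω} (hφ : φ ∈ H20 Ω)
    (hb : MemLp (val φ) ⊤ (volume.restrict (Ω : Set (EuclideanSpace ℝ (Fin d)))))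
    {z : ℝ} (hz : 0 < z) {s : Finset ℕ} (hzs : ∀ j ∉ s, z ≤ σ j) :
    volume.real (Metric.ball (0 : EuclideanSpace ℝ (Fin d)) 1) * Real.sqrt z ^ d *
        (2 * d / ((d + 2) * (d + 4)) * ‖val φ‖ ^ 2 * z ^ 2 - (∑ i, ‖grad φ i‖ ^ 2) * z
          - ‖lap φ‖ ^ 2) ≤
      (2 * Real.pi) ^ d * ((eLpNorm (val φ) ⊤
        (volume.restrict (Ω : Set (EuclideanSpace ℝ (Fin d))))).toReal ^ 2 *
          ∑ j ∈ s, max (z - σ j) 0 * σ j) := by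
  obtain ⟨b, hbT⟩ := hσ.exists_hilbertBasis hc hs hpos
  set M := (eLpNorm (val φ) ⊤ (volume.restrict (Ω : Set (EuclideanSpace ℝ (Fin d))))).toReal
  have hcoef : ∀ j, 0 ≤ max (z - σ j) 0 * σ j := fun j =>
    mul_nonneg (le_max_right _ _) (hσ.pos j).le
  let g : ℕ → L2 Ω := fun j => boundedMul (val φ) hb (b j : L2 Ω)
  have hwave : ∀ ξ θ, z * (∑ i, ‖grad (waveJet ξ θ φ) i‖ ^ 2) - ‖lap (waveJet ξ θ φ)‖ ^ 2 ≤
      ∑ j ∈ s, max (z - σ j) 0 * σ j * inner ℝ (g j) (waveL2 Ω ξ θ) ^ 2 := by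
    intro ξ θ
    have hm := waveJet_mem hφ ξ θ
    obtain ⟨k, hk⟩ := S.surjective ⟨_, hm⟩
    have hk' : (S k : Jet Ω) = waveJet ξ θ φ := by rw [hk]
    have h := hσ.quadratic_bound hs b hbT z k hzs
    have h1 : inner ℝ (T k) k = ∑ i, ‖grad (waveJet ξ θ φ) i‖ ^ 2 := by
      rw [hT, hk']
      exact Finset.sum_congr rfl fun i _ => real_inner_self_eq_norm_sq _
    have h2 : ‖k‖ = ‖lap (waveJet ξ θ φ)‖ := by
      rw [← hk', hS]; rfl
    -- Green's formula trades the gradient of the eigenfunction `S (b j)` for its Laplacian `b j`,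
    -- so only the product of `val φ` and `b j` is left.
    have h3 : ∀ j, inner ℝ (T k) (b j) = -inner ℝ (g j) (waveL2 Ω ξ θ) := fun j => by
      rw [hT, sum_inner_grad_eq (S k).2 (S (b j)).2, hS, hk', ← inner_waveMul]
      rfl
    simp only [h1, h2, h3, neg_sq] at h
    exact h
  have hpoint : ∀ ξ : EuclideanSpace ℝ (Fin d),
      z * (∑ i, ‖grad φ i‖ ^ 2) + z * ‖val φ‖ ^ 2 * ‖ξ‖ ^ 2 - ‖lap φ‖ ^ 2
        - 2 * (∑ i, ‖grad φ i‖ ^ 2) * ‖ξ‖ ^ 2 - ‖val φ‖ ^ 2 * ‖ξ‖ ^ 4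
        - 4 * ∑ i, ∑ j, inner ℝ (grad φ i) (grad φ j) * (ξ i * ξ j) ≤
      ∑ j ∈ s, max (z - σ j) 0 * σ j * spectralDensity (g j) ξ := fun ξ => by
    rw [← quadratic_waveJet hφ ξ z]
    refine (add_le_add (hwave ξ 0) (hwave ξ _)).trans_eq ?_
    rw [← Finset.sum_add_distrib]
    exact Finset.sum_congr rfl fun j _ => by rw [spectralDensity, mul_add]
  have hint : Integrable fun ξ => ∑ j ∈ s, max (z - σ j) 0 * σ j * spectralDensity (g j) ξ :=
    integrable_finsetSum _ fun j _ => (integrable_spectralDensity _).const_mul _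
  rw [← setIntegral_symbol hd φ hz]
  -- The ball `|ξ|² ≤ z` is where the term `‖φ‖² |ξ|² (z - |ξ|²)` is nonnegative. The right side is
  -- nonnegative everywhere, so it may be integrated over the whole space, as Plancherel requires.
  calc _ ≤ ∫ ξ in Metric.closedBall (0 : EuclideanSpace ℝ (Fin d)) (Real.sqrt z),
          ∑ j ∈ s, max (z - σ j) 0 * σ j * spectralDensity (g j) ξ :=
        integral_mono (integrableOn_ball (by fun_prop)) hint.integrableOn hpoint
    _ ≤ ∫ ξ, ∑ j ∈ s, max (z - σ j) 0 * σ j * spectralDensity (g j) ξ :=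
        setIntegral_le_integral hint (Eventually.of_forall fun ξ =>
          Finset.sum_nonneg fun j _ => mul_nonneg (hcoef j) (spectralDensity_nonneg _ _))
    _ = ∑ j ∈ s, max (z - σ j) 0 * σ j * ((2 * Real.pi) ^ d * ‖g j‖ ^ 2) := by
        rw [integral_finsetSum _ fun j _ => (integrable_spectralDensity _).const_mul _]
        exact Finset.sum_congr rfl fun j _ => by
          rw [integral_const_mul, integral_spectralDensity]
    _ ≤ ∑ j ∈ s, max (z - σ j) 0 * σ j * ((2 * Real.pi) ^ d * M ^ 2) := by
        refine Finset.sum_le_sum fun j _ => mul_le_mul_of_nonneg_left ?_ (hcoef j)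
        have h1 : ‖g j‖ ≤ M := by
          have h2 := norm_boundedMul_le (val φ) hb (b j : L2 Ω)
          -- The eigenfunctions are normalised by `‖Δv_j‖ = 1`, so only the sup norm of `φ` remains.
          have h3 : ‖(b j : L2 Ω)‖ = 1 := b.orthonormal.1 j
          rwa [h3, mul_one] at h2
        gcongr
    _ = _ := by rw [← Finset.sum_mul]; ring

end Main

end Buckling

end

theorem theorem2p7 {d : ℕ} (hd : 0 < d) (Ω : TopologicalSpace.Opens (EuclideanSpace ℝ (Fin d)))
    (hΩ : IsConnected (Ω : Set (EuclideanSpace ℝ (Fin d))))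
    (hvol : MeasureTheory.volume (Ω : Set (EuclideanSpace ℝ (Fin d))) ≠ ⊤) :
    (∃ σ : ℕ → ℝ, Buckling.IsEigenvalueSequence Ω σ) ∧
    ∀ σ : ℕ → ℝ, Buckling.IsEigenvalueSequence Ω σ →
      ∀ φ ∈ Buckling.H20 Ω,
        MeasureTheory.MemLp (Buckling.val φ) ⊤
          (MeasureTheory.volume.restrict (Ω : Set (EuclideanSpace ℝ (Fin d)))) →
        ∀ z : ℝ, 0 < z →
          Summable (fun j => max (z - σ j) 0 * σ j) ∧
          2 * (d : ℝ) * MeasureTheory.volume.real (Metric.ball (0 : EuclideanSpace ℝ (Fin d)) 1) *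
                ‖Buckling.val φ‖ ^ 2 / (((d : ℝ) + 2) * ((d : ℝ) + 4)) *
                (2 * Real.pi) ^ (-(d : ℝ)) * z ^ (2 + (d : ℝ) / 2)
              - MeasureTheory.volume.real (Metric.ball (0 : EuclideanSpace ℝ (Fin d)) 1) *
                (2 * Real.pi) ^ (-(d : ℝ)) * (∑ i, ‖Buckling.grad φ i‖ ^ 2) *
                z ^ (1 + (d : ℝ) / 2)
              - MeasureTheory.volume.real (Metric.ball (0 : EuclideanSpace ℝ (Fin d)) 1) *
                (2 * Real.pi) ^ (-(d : ℝ)) * ‖Buckling.lap φ‖ ^ 2 * z ^ ((d : ℝ) / 2)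
            ≤ (MeasureTheory.eLpNorm (Buckling.val φ) ⊤
                  (MeasureTheory.volume.restrict (Ω : Set (EuclideanSpace ℝ (Fin d))))).toReal ^ 2 *
                ∑' j, max (z - σ j) 0 * σ j := by
  have : IsFiniteMeasure (volume.restrict (Ω : Set (EuclideanSpace ℝ (Fin d)))) :=
    isFiniteMeasure_restrict.2 hvol
  obtain ⟨K, hK, S, T, hc, hs, hS, hT, hpos⟩ := Buckling.exists_bucklingOperator Ω hd
  refine ⟨?_, fun σ hσ φ hφ hb z hz => ?_⟩
  · have hinf : ¬ FiniteDimensional ℝ K := fun h =>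
      Buckling.not_finiteDimensional_H20 hd hΩ.nonempty (Module.Finite.equiv S)
    obtain ⟨σ, hσ⟩ := Buckling.exists_isRecipSpectrum hinf hc hs hpos
    exact ⟨σ, (Buckling.isEigenvalueSequence_iff hc hS hT).2 hσ⟩
  · have hσ' := (Buckling.isEigenvalueSequence_iff hc hS hT).1 hσ
    have hfin : {j | ¬ z ≤ σ j}.Finite := by
      have h := tendsto_atTop.1 hσ.tendsto z
      rw [← Nat.cofinite_eq_atTop] at h
      exact h
    have hzs : ∀ j ∉ hfin.toFinset, z ≤ σ j := fun j hj => by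
      simpa using hj
    -- Only the finitely many `j` with `σ j < z` contribute, so the series is a finite sum.
    have hsupp : ∀ j ∉ hfin.toFinset, max (z - σ j) 0 * σ j = 0 := fun j hj => by
      rw [max_eq_right (sub_nonpos.2 (hzs j hj)), zero_mul]
    refine ⟨summable_of_ne_finset_zero hsupp, ?_⟩
    rw [tsum_eq_sum hsupp]
    have h := Buckling.rieszMean_lower_bound hd hc hs hS hT hpos hσ' hφ hb hz hzs
    have hP : 0 < (2 * Real.pi) ^ d := by positivity
    have e0 : (2 * Real.pi) ^ (-(d : ℝ)) = ((2 * Real.pi) ^ d)⁻¹ := by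
      rw [Real.rpow_neg (by positivity), Real.rpow_natCast]
    have e1 : z ^ ((d : ℝ) / 2) = Real.sqrt z ^ d := by
      rw [Real.sqrt_eq_rpow, ← Real.rpow_natCast, ← Real.rpow_mul hz.le]
      congr 1; ring
    have e2 : z ^ (1 + (d : ℝ) / 2) = z * Real.sqrt z ^ d := by
      rw [Real.rpow_add hz, Real.rpow_one, e1]
    have e3 : z ^ (2 + (d : ℝ) / 2) = z ^ 2 * Real.sqrt z ^ d := by
      rw [Real.rpow_add hz, e1, Real.rpow_two]
    rw [e0, e1, e2, e3]
    refine le_of_eq_of_le ?_ ((inv_mul_le_iff₀ hP).2 h)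
    ring
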